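/- Let $d\ge 1$, let $\Omega\subset\mathbb R^d$ be a bounded open set with boundary $\partial\Omega$, and let $\theta\in\mathbb R^d$ with $|\theta|=1$. All functions are real valued. **Notation.** $W_\theta(\Omega)$ is the set of $u\in L^2(\Omega)$ for which there is $\partial_\theta u\in L^2(\Omega)$ with $\int_\Omega u\,(\theta\cdot\nabla\varphi)\,dx=-\int_\Omega(\partial_\theta u)\,\varphi\,dx$ for all $\varphi\in C_c^\infty(\Omega)$. For $x\in\Omega$ put $\delta_\theta(x)=\sup\{s\ge 0: x+t\theta\in\Omega\ \text{for all } t\in[0,s)\}$ and $\Phi_\theta(x)=x+\delta_\theta(x)\theta\in\partial\Omega$, and similarly with $-\theta$; let $\partial_\theta\Omega=\Phi_\theta(\Omega)$. For $z=\Phi_\theta(x)\in\partial_\theta\Omega$ with $x\in\Omega$ put $\Phi_{-\theta}(z)=\Phi_{-\theta}(x)$ (this does not depend on the choice of $x$) and $\ell_{-\theta}(z)=|\Phi_{-\theta}(z)-z|>0$. The directional measure is the finite Borel measure on $\partial\Omega$ given by $\mu_\theta(A)=\lambda^d(\{x\in\Omega:\Phi_\theta(x)\in A\})$; it is carried by $\partial_\theta\Omega$.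 Let $P_\theta(x)=x-(x\cdot\theta)\theta$ and, for $y\in P_\theta(\Omega)$, let $\omega_\theta(y)=\{s\in\mathbb R: s\theta+y\in\Omega\}$. A function $g:\partial\Omega\to\mathbb R$ is a directional trace of $u\in W_\theta(\Omega)$ in the direction $\theta$ if there are a representative of $u$, again denoted by $u$, and a set $A\subset P_\theta(\Omega)$ such that $P_\theta(\Omega)\setminus A$ is negligible for the $(d-1)$-dimensional Lebesgue measure of the hyperplane $\theta^\perp$ and, for every $y\in A$, the function $s\mapsto u(s\theta+y)$ belongs to $H^1(\omega_\theta(y))$ and, for every connected component $(\alpha,\beta)$ of $\omega_\theta(y)$, its representative that is continuous on $(\alpha,\beta]$ takes at $\beta$ the value $g(\beta\theta+y)$. Denote by $\gamma_\theta u$ any directional trace of $u$ in the direction $\theta$, and by $\gamma_{-\theta}u$ any directional trace of $u$ in the direction $-\theta$ (defined in the same way with $-\theta$ in place of $\theta$; note that $W_{-\theta}(\Omega)=W_\theta(\Omega)$). **Theorem (integration-by-parts formula).** Let $u,v\in W_\theta(\Omega)$. Then $u$ and $v$ have directional traces in the directions $\theta$ and $-\theta$. For every choice of these traces, the function $$z\mapsto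 \frac{\gamma_\theta u(z)\,\gamma_\theta v(z)-\gamma_{-\theta}u(\Phi_{-\theta}(z))\,\gamma_{-\theta}v(\Phi_{-\theta}(z))}{\ell_{-\theta}(z)}$$ is $\mu_\theta$-integrable on $\partial\Omega$, the function $u\,\partial_\theta v+v\,\partial_\theta u$ is integrable on $\Omega$, and $$\int_\Omega\big(u\,\partial_\theta v+v\,\partial_\theta u\big)\,dx=\int_{\partial\Omega}\frac{\gamma_\theta u(z)\,\gamma_\theta v(z)-\gamma_{-\theta}u(\Phi_{-\theta}(z))\,\gamma_{-\theta}v(\Phi_{-\theta}(z))}{\ell_{-\theta}(z)}\,d\mu_\theta(z).$$ -/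

import Mathlib

open MeasureTheory Set
open scoped ENNReal RealInnerProductSpace ContDiff

noncomputable section

namespace DirectionalTrace

/-- `ℝ^d` with its Euclidean norm. -/
abbrev E (d : ℕ) : Type := EuclideanSpace ℝ (Fin d)

/-- `L²(Ω)`, real valued, as a space of classes of functions. -/
abbrev L2 {d : ℕ} (Ω : Set (E d)) : Type := Lp ℝ 2 ((volume : Measure (E d)).restrict Ω)

/-! ### The space of functions with a directional derivative -/

/-- `C^∞_c(Ω)`: smooth functions whose support is a compact subset of `Ω`. -/
def IsTestFunction {V : Type*} [NormedAddCommGroup V] [NormedSpace ℝ V] (Ω : Set V)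
    (φ : V → ℝ) : Prop :=
  ContDiff ℝ ∞ φ ∧ HasCompactSupport φ ∧ tsupport φ ⊆ Ω

/-- `w ∈ L²(Ω)` is a weak derivative of `u ∈ L²(Ω)` in the direction `θ`. -/
def HasWeakDirDeriv {d : ℕ} (Ω : Set (E d)) (θ : E d) (u w : L2 Ω) : Prop :=
  ∀ φ : E d → ℝ, IsTestFunction Ω φ →
    ∫ x in Ω, u x * fderiv ℝ φ x θ = -∫ x in Ω, w x * φ x

/-- The space `W_θ(Ω)` of the `u ∈ L²(Ω)` such that `∂_θ u ∈ L²(Ω)`. -/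
def W {d : ℕ} (Ω : Set (E d)) (θ : E d) : Set (L2 Ω) :=
  {u | ∃ w : L2 Ω, HasWeakDirDeriv Ω θ u w}

open Classical in
/-- The weak derivative `∂_θ u` of `u ∈ W_θ(Ω)` (and `0` if `u ∉ W_θ(Ω)`). -/
def dirDeriv {d : ℕ} (Ω : Set (E d)) (θ : E d) (u : L2 Ω) : L2 Ω :=
  if h : ∃ w : L2 Ω, HasWeakDirDeriv Ω θ u w then h.choose else 0

theorem dirDeriv_spec {d : ℕ} {Ω : Set (E d)} {θ : E d} {u : L2 Ω} (hu : u ∈ W Ω θ) :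
    HasWeakDirDeriv Ω θ u (dirDeriv Ω θ u) := by
  have h : ∃ w : L2 Ω, HasWeakDirDeriv Ω θ u w := hu
  rw [dirDeriv, dif_pos h]
  exact h.choose_spec

/-- The weak derivative in the direction `θ` is unique. -/
theorem HasWeakDirDeriv.unique {d : ℕ} {Ω : Set (E d)} (hΩ : IsOpen Ω) {θ : E d} {u w₁ w₂ : L2 Ω}
    (h₁ : HasWeakDirDeriv Ω θ u w₁) (h₂ : HasWeakDirDeriv Ω θ u w₂) : w₁ = w₂ := by
  have hloc : LocallyIntegrableOn (fun x => w₁ x - w₂ x) Ω volume := by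
    have hL : LocallyIntegrable (fun x => w₁ x - w₂ x) (volume.restrict Ω) :=
      ((Lp.memLp w₁).sub (Lp.memLp w₂)).locallyIntegrable (by norm_num)
    intro x _
    obtain ⟨U, hU, hUi⟩ := hL x
    obtain ⟨V, hVU, hVo, hxV⟩ := mem_nhds_iff.1 hU
    refine ⟨Ω ∩ V, inter_mem_nhdsWithin Ω (hVo.mem_nhds hxV), ?_⟩
    have hVi := hUi.mono_set hVU
    rwa [IntegrableOn, Measure.restrict_restrict hVo.measurableSet, inter_comm] at hVi
  have key := hΩ.ae_eq_zero_of_integral_contDiff_smul_eq_zero hloc ?_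
  · refine Lp.ext ?_
    rw [Filter.EventuallyEq, ae_restrict_iff' hΩ.measurableSet]
    filter_upwards [key] with x hx hxΩ
    exact sub_eq_zero.1 (hx hxΩ)
  · intro φ h1 h2 h3
    have hφ : MemLp φ 2 ((volume : Measure (E d)).restrict Ω) :=
      (h1.continuous.memLp_of_hasCompactSupport h2).restrict Ω
    have e := (h₁ φ ⟨h1, h2, h3⟩).symm.trans (h₂ φ ⟨h1, h2, h3⟩)
    have i₁ : Integrable (fun x => w₁ x * φ x) (volume.restrict Ω) := (Lp.memLp w₁).integrable_mul hφ
    have i₂ : Integrable (fun x => w₂ x * φ x) (volume.restrict Ω) := (Lp.memLp w₂).integrable_mul hφ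
    rw [← setIntegral_eq_integral_of_forall_compl_eq_zero (s := Ω)]
    · have : ∀ x, φ x • (w₁ x - w₂ x) = w₁ x * φ x - w₂ x * φ x := fun x => by
        simp only [smul_eq_mul]; ring
      simp only [this]
      rw [integral_sub i₁ i₂]
      linarith
    · intro x hx
      rw [image_eq_zero_of_notMem_tsupport (fun h => hx (h3 h)), zero_smul]

/-! ### Chords of `Ω` in the direction `θ` -/

/-- `δ_θ(x)`, the distance from `x ∈ Ω` to the boundary along the half-line directed by `θ`. -/
def exitTime {d : ℕ} (Ω : Set (E d)) (θ x : E d) : ℝ :=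
  sSup {s : ℝ | 0 ≤ s ∧ ∀ t ∈ Ico 0 s, x + t • θ ∈ Ω}

/-- `Φ_θ(x) = x + δ_θ(x) θ`, for `x ∈ Ω`. -/
def exitPoint {d : ℕ} (Ω : Set (E d)) (θ x : E d) : E d :=
  x + exitTime Ω θ x • θ

theorem exitTime_eq {d : ℕ} {Ω : Set (E d)} {θ x : E d} {r : ℝ} (hr : 0 ≤ r)
    (h : ∀ t ∈ Ico 0 r, x + t • θ ∈ Ω) (hr' : x + r • θ ∉ Ω) : exitTime Ω θ x = r := by
  have : {s : ℝ | 0 ≤ s ∧ ∀ t ∈ Ico 0 s, x + t • θ ∈ Ω} = Icc 0 r := by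
    ext s
    refine ⟨fun hs => ⟨hs.1, ?_⟩, fun hs => ⟨hs.1, fun t ht => h t ⟨ht.1, ht.2.trans_le hs.2⟩⟩⟩
    by_contra hc
    exact hr' (hs.2 r ⟨hr, not_le.1 hc⟩)
  rw [exitTime, this, csSup_Icc hr]

theorem exitTime_spec {d : ℕ} {Ω : Set (E d)} (hΩ : IsOpen Ω) (hb : Bornology.IsBounded Ω)
    {θ : E d} (hθ : ‖θ‖ = 1) (x : E d) :
    0 ≤ exitTime Ω θ x ∧ (∀ t ∈ Ico 0 (exitTime Ω θ x), x + t • θ ∈ Ω) ∧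
      x + exitTime Ω θ x • θ ∉ Ω := by
  set T : Set ℝ := {t | 0 ≤ t ∧ x + t • θ ∉ Ω} with hT
  have hcont : Continuous fun t : ℝ => x + t • θ := by fun_prop
  have hTc : IsClosed T := isClosed_Ici.inter (hΩ.isClosed_compl.preimage hcont)
  have hTb : BddBelow T := ⟨0, fun t ht => ht.1⟩
  have hTn : T.Nonempty := by
    obtain ⟨R, hR⟩ := hb.exists_norm_le
    refine ⟨|R| + ‖x‖ + 1, by positivity, fun hc => ?_⟩
    have h1 := hR _ hc
    have h2 : ‖(|R| + ‖x‖ + 1) • θ‖ = |R| + ‖x‖ + 1 := by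
      rw [norm_smul, hθ, mul_one, Real.norm_of_nonneg (by positivity)]
    have h3 := norm_sub_le (x + (|R| + ‖x‖ + 1) • θ) x
    rw [add_sub_cancel_left, h2] at h3
    linarith [le_abs_self R]
  have hm := hTc.csInf_mem hTn hTb
  have hlt : ∀ t ∈ Ico 0 (sInf T), x + t • θ ∈ Ω := by
    intro t ht
    by_contra hc
    exact absurd (csInf_le hTb ⟨ht.1, hc⟩) (not_le.2 ht.2)
  rw [exitTime_eq hm.1 hlt hm.2]
  exact ⟨hm.1, hlt, hm.2⟩

open Classical in
/-- The extension of `Φ_{-θ}` to `∂_θ Ω = Φ_θ(Ω)`: the point `z = Φ_θ(x)`, `x ∈ Ω`, is sent to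
`Φ_{-θ}(x)`, the other end of the chord (see `oppositePoint_exitPoint`). -/
def oppositePoint {d : ℕ} (Ω : Set (E d)) (θ z : E d) : E d :=
  if h : ∃ x ∈ Ω, exitPoint Ω θ x = z then exitPoint Ω (-θ) h.choose else z

/-- `ℓ_{-θ}(z) = |ẑ - z|`, the length of the chord that ends at `z ∈ ∂_θ Ω`. -/
def chordLength {d : ℕ} (Ω : Set (E d)) (θ z : E d) : ℝ :=
  ‖oppositePoint Ω θ z - z‖

theorem exitPoint_neg_eq {d : ℕ} {Ω : Set (E d)} (hΩ : IsOpen Ω) (hb : Bornology.IsBounded Ω)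
    {θ : E d} (hθ : ‖θ‖ = 1) {x x' : E d} (hx' : x' ∈ Ω)
    (h : exitPoint Ω θ x = exitPoint Ω θ x') (hle : exitTime Ω θ x' ≤ exitTime Ω θ x) :
    exitPoint Ω (-θ) x' = exitPoint Ω (-θ) x := by
  have hθ' : ‖-θ‖ = 1 := by rwa [norm_neg]
  obtain ⟨-, a2, -⟩ := exitTime_spec hΩ hb hθ x
  obtain ⟨p0, -, -⟩ := exitTime_spec hΩ hb hθ x'
  obtain ⟨b1, b2, b3⟩ := exitTime_spec hΩ hb hθ' x
  set c := exitTime Ω θ x - exitTime Ω θ x' with hc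
  set e := exitTime Ω (-θ) x with he
  have hxx : x' = x + c • θ := by
    simp only [exitPoint] at h
    rw [hc, sub_smul, add_sub, h, add_sub_cancel_right]
  have hc0 : 0 ≤ c := sub_nonneg.2 hle
  have hmove : ∀ t : ℝ, x' + t • -θ = x + (t - c) • -θ := by
    intro t; rw [hxx]; module
  have key : exitTime Ω (-θ) x' = e + c := by
    refine exitTime_eq (by linarith) (fun t ht => ?_) ?_
    · rcases eq_or_lt_of_le ht.1 with h0 | h0
      · rw [← h0]; simpa using hx'
      · rw [hmove]
        rcases le_total t c with htc | htc
        · have := a2 (c - t) ⟨by linarith, by linarith⟩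
          convert this using 1
          module
        · exact b2 _ ⟨by linarith, by linarith [ht.2]⟩
    · rw [hmove, add_sub_cancel_right]; exact b3
  rw [exitPoint, key, hmove, add_sub_cancel_right, exitPoint]

/-- `Φ_{-θ}` on `∂_θ Ω` is well defined: it sends `Φ_θ(x)` to `Φ_{-θ}(x)`. -/
theorem oppositePoint_exitPoint {d : ℕ} {Ω : Set (E d)} (hΩ : IsOpen Ω)
    (hb : Bornology.IsBounded Ω) {θ : E d} (hθ : ‖θ‖ = 1) {x : E d} (hx : x ∈ Ω) :
    oppositePoint Ω θ (exitPoint Ω θ x) = exitPoint Ω (-θ) x := by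
  have h : ∃ x' ∈ Ω, exitPoint Ω θ x' = exitPoint Ω θ x := ⟨x, hx, rfl⟩
  rw [oppositePoint, dif_pos h]
  obtain ⟨h1, h2⟩ := h.choose_spec
  rcases le_total (exitTime Ω θ h.choose) (exitTime Ω θ x) with hle | hle
  · exact exitPoint_neg_eq hΩ hb hθ h1 h2.symm hle
  · exact (exitPoint_neg_eq hΩ hb hθ hx h2 hle).symm

/-- The chord through `x ∈ Ω` has length `ℓ_θ(x) = δ_θ(x) + δ_{-θ}(x)`. -/
theorem chordLength_exitPoint {d : ℕ} {Ω : Set (E d)} (hΩ : IsOpen Ω)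
    (hb : Bornology.IsBounded Ω) {θ : E d} (hθ : ‖θ‖ = 1) {x : E d} (hx : x ∈ Ω) :
    chordLength Ω θ (exitPoint Ω θ x) = exitTime Ω θ x + exitTime Ω (-θ) x := by
  have hθ' : ‖-θ‖ = 1 := by rwa [norm_neg]
  have h1 := (exitTime_spec hΩ hb hθ x).1
  have h2 := (exitTime_spec hΩ hb hθ' x).1
  rw [chordLength, oppositePoint_exitPoint hΩ hb hθ hx]
  have : exitPoint Ω (-θ) x - exitPoint Ω θ x
      = (exitTime Ω θ x + exitTime Ω (-θ) x) • -θ := by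
    simp only [exitPoint]; module
  rw [this, norm_smul, hθ', mul_one, Real.norm_of_nonneg (by linarith)]

/-- The directional measure `μ_θ`, `μ_θ(A) = ∫_Ω χ_A(Φ_θ(x)) dx`, as a measure on `ℝ^d`
(carried by `∂Ω`). -/
def dirMeasure {d : ℕ} (Ω : Set (E d)) (θ : E d) : Measure (E d) :=
  (volume.restrict Ω).map (exitPoint Ω θ)

theorem aemeasurable_exitPoint {d : ℕ} {Ω : Set (E d)} (hΩ : IsOpen Ω)
    (hb : Bornology.IsBounded Ω) {θ : E d} (hθ : ‖θ‖ = 1) :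
    AEMeasurable (exitPoint Ω θ) (volume.restrict Ω) := by
  have hm : Measurable (exitTime Ω θ) := by
    refine measurable_of_Ioi fun r => IsOpen.measurableSet ?_
    rcases lt_or_ge r 0 with hr | hr
    · convert isOpen_univ
      exact eq_univ_of_forall fun x => hr.trans_le (exitTime_spec hΩ hb hθ x).1
    · have : exitTime Ω θ ⁻¹' Ioi r = {x | ∀ t ∈ Icc 0 r, x + t • θ ∈ Ω} := by
        ext x
        obtain ⟨h0, h1, h2⟩ := exitTime_spec hΩ hb hθ x
        refine ⟨fun h t ht => h1 t ⟨ht.1, ht.2.trans_lt h⟩, fun h => ?_⟩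
        by_contra hc
        exact h2 (h _ ⟨h0, not_lt.1 hc⟩)
      rw [this, isOpen_iff_mem_nhds]
      intro x hx
      refine isCompact_Icc.eventually_forall_of_forall_eventually fun t ht => ?_
      have hc : Continuous fun p : E d × ℝ => p.1 + p.2 • θ := by fun_prop
      exact hc.continuousAt.eventually (hΩ.mem_nhds (hx t ht))
  have : Measurable (exitPoint Ω θ) := measurable_id.add (hm.smul_const θ)
  exact this.aemeasurable

/-- `μ_θ(A)` is the Lebesgue measure of the set of the `x ∈ Ω` such that `Φ_θ(x) ∈ A`. -/
theorem dirMeasure_apply {d : ℕ} {Ω : Set (E d)} (hΩ : IsOpen Ω)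
    (hb : Bornology.IsBounded Ω) {θ : E d} (hθ : ‖θ‖ = 1) {A : Set (E d)} (hA : MeasurableSet A) :
    dirMeasure Ω θ A = volume {x ∈ Ω | exitPoint Ω θ x ∈ A} := by
  rw [dirMeasure, Measure.map_apply_of_aemeasurable (aemeasurable_exitPoint hΩ hb hθ) hA,
    Measure.restrict_apply' hΩ.measurableSet, inter_comm]
  rfl

/-! ### Directional traces -/

/-- The orthogonal projection on the hyperplane orthogonal to the unit vector `θ`. -/
def proj {d : ℕ} (θ x : E d) : E d := x - ⟪x, θ⟫ • θ

/-- The `(d-1)`-dimensional Lebesgue measure of the hyperplane orthogonal to `θ`, as a measure on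
`ℝ^d`. -/
def hyperplaneMeasure {d : ℕ} (θ : E d) : Measure (E d) :=
  ((stdOrthonormalBasis ℝ (ℝ ∙ θ)ᗮ).toBasis.addHaar).map Subtype.val

/-- `ω_θ(y) = {s : sθ + y ∈ Ω}`. -/
def slice {d : ℕ} (Ω : Set (E d)) (θ y : E d) : Set ℝ := {s | s • θ + y ∈ Ω}

/-- `]α, β[` is one of the maximal bounded open intervals of the open set `S ⊆ ℝ`. -/
def IsComponentInterval (S : Set ℝ) (α β : ℝ) : Prop :=
  α < β ∧ Ioo α β ⊆ S ∧ α ∉ S ∧ β ∉ S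

/-- `f` is (a representative of) an element of `H¹(S)`, for an open set `S ⊆ ℝ`. -/
def MemH1 (S : Set ℝ) (f : ℝ → ℝ) : Prop :=
  MemLp f 2 (volume.restrict S) ∧ ∃ w : ℝ → ℝ, MemLp w 2 (volume.restrict S) ∧
    ∀ φ : ℝ → ℝ, IsTestFunction S φ →
      ∫ s in S, f s * deriv φ s = -∫ s in S, w s * φ s

/-- The directional trace `γ_θ u`: the set of all directional traces `g` of `u` in the
direction `θ`. In the last line, `h` is the representative of `s ↦ u(sθ + y)` that is continuous
on `]α, β]`. Only the values of `g` on `∂Ω` matter. -/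
def dirTrace {d : ℕ} (Ω : Set (E d)) (θ : E d) (u : L2 Ω) : Set (E d → ℝ) :=
  {g | ∃ f : E d → ℝ, f =ᵐ[volume.restrict Ω] u ∧ ∃ A ⊆ proj θ '' Ω,
    hyperplaneMeasure θ (proj θ '' Ω \ A) = 0 ∧
    ∀ y ∈ A, MemH1 (slice Ω θ y) (fun s => f (s • θ + y)) ∧
      ∀ α β : ℝ, IsComponentInterval (slice Ω θ y) α β →
        ∃ h : ℝ → ℝ, h =ᵐ[volume.restrict (Ioo α β)] (fun s => f (s • θ + y)) ∧
          ContinuousOn h (Ioc α β) ∧ g (β • θ + y) = h β}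

end DirectionalTrace

end

/-! Averaging a function over the chords of `Ω` in the direction `θ` preserves its integral, because
the kernel of the uniform average over a chord is symmetric: the shear `(x, s) ↦ (x + s • θ, -s)`
preserves Lebesgue measure and exchanges the two ends of a displacement along a chord. On almost
every chord `u` and `v` agree almost everywhere with absolutely continuous primitives of `∂_θ u`
and `∂_θ v`, whose values at the ends of the chord are the traces. By the product rule, the average
of `u ∂_θ v + v ∂_θ u` over the chord through `x` is therefore the integrand of the boundary term at
`Φ_θ(x)`, and the integral of the latter over `Ω` is an integral against `μ_θ`, the image of
Lebesgue measure under `Φ_θ`. -/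

noncomputable section

namespace DirectionalTrace

/-! ### Chords of a set -/

section ChordSet

variable {V : Type*} [AddCommGroup V] [Module ℝ V] {Ω : Set V} {θ x : V} {r s : ℝ}

/-- The parameters `s` for which the segment from `x` to `x + s • θ` lies in `Ω`. For `x ∈ Ω` this
parametrizes the chord of `Ω` through `x` in the direction `θ`, with origin at `x`; for `x ∉ Ω` it
is empty. -/
def chordSet (Ω : Set V) (θ x : V) : Set ℝ := {s | ∀ t ∈ uIcc 0 s, x + t • θ ∈ Ω}

theorem zero_mem_chordSet (hx : x ∈ Ω) : (0 : ℝ) ∈ chordSet Ω θ x := by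
  simpa [chordSet] using hx

theorem add_smul_mem_of_mem_chordSet (hs : s ∈ chordSet Ω θ x) : x + s • θ ∈ Ω :=
  hs s right_mem_uIcc

theorem mem_of_mem_chordSet (hs : s ∈ chordSet Ω θ x) : x ∈ Ω := by
  simpa using hs 0 left_mem_uIcc

theorem chordSet_eq_empty (hx : x ∉ Ω) : chordSet Ω θ x = ∅ :=
  eq_empty_of_forall_notMem fun _ h => hx (mem_of_mem_chordSet h)

theorem ordConnected_chordSet (Ω : Set V) (θ x : V) : (chordSet Ω θ x).OrdConnected :=
  ordConnected_of_uIcc_subset_left (x := 0) fun _ hs _ hr t ht =>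
    hs t (uIcc_subset_uIcc_left hr ht)

theorem mem_chordSet_iff_forall_Icc :
    s ∈ chordSet Ω θ x ↔ ∀ t ∈ Icc (0 : ℝ) 1, x + (t * s) • θ ∈ Ω := by
  simp only [chordSet, mem_ofPred_eq, ← segment_eq_uIcc, segment_eq_image, forall_mem_image,
    smul_eq_mul, mul_zero, zero_add]

theorem add_mem_chordSet (hs : s ∈ chordSet Ω θ x) (hr : r ∈ chordSet Ω θ (x + s • θ)) :
    s + r ∈ chordSet Ω θ x := by
  intro t ht
  rcases uIcc_subset_uIcc_union_uIcc (b := s) ht with h | h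
  · exact hs t h
  · have hts : t - s ∈ uIcc (s - s) (s + r - s) :=
      image_sub_const_uIcc s s (s + r) ▸ mem_image_of_mem (· - s) h
    simpa [add_assoc, ← add_smul] using hr (t - s) (by simpa using hts)

theorem neg_mem_chordSet (hs : s ∈ chordSet Ω θ x) : -s ∈ chordSet Ω θ (x + s • θ) := by
  intro t ht
  rw [add_assoc, ← add_smul]
  have hst : s + t ∈ uIcc (s + 0) (s + -s) :=
    image_const_add_uIcc s 0 (-s) ▸ mem_image_of_mem (s + ·) ht
  exact hs _ (by simpa [uIcc_comm] using hst)

theorem neg_mem_chordSet_add_smul_iff : -s ∈ chordSet Ω θ (x + s • θ) ↔ s ∈ chordSet Ω θ x :=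
  ⟨fun h => by simpa using neg_mem_chordSet h, neg_mem_chordSet⟩

theorem mem_chordSet_add_smul (hs : s ∈ chordSet Ω θ x) :
    r ∈ chordSet Ω θ (x + s • θ) ↔ s + r ∈ chordSet Ω θ x := by
  refine ⟨add_mem_chordSet hs, fun h => ?_⟩
  simpa using add_mem_chordSet (neg_mem_chordSet hs) (r := s + r) (by simpa using h)

theorem chordSet_add_smul (hs : s ∈ chordSet Ω θ x) :
    chordSet Ω θ (x + s • θ) = (fun r => s + r) ⁻¹' chordSet Ω θ x :=
  Set.ext fun _ => mem_chordSet_add_smul hs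

theorem volume_chordSet_add_smul (hs : s ∈ chordSet Ω θ x) :
    volume (chordSet Ω θ (x + s • θ)) = volume (chordSet Ω θ x) := by
  rw [chordSet_add_smul hs, measure_preimage_add]

theorem add_smul_right_notMem_of_chordSet_eq_Ioo {a b : ℝ} (hab : chordSet Ω θ x = Ioo a b)
    (ha : a < 0) (hb : 0 ≤ b) : x + b • θ ∉ Ω := by
  intro hmem
  have hb' : b ∈ chordSet Ω θ x := by
    intro t ht
    rw [uIcc_of_le hb] at ht
    rcases ht.2.eq_or_lt with rfl | htb
    · exact hmem
    · exact add_smul_mem_of_mem_chordSet (hab ▸ ⟨ha.trans_le ht.1, htb⟩)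
  exact (hab ▸ hb').2.false

theorem add_smul_left_notMem_of_chordSet_eq_Ioo {a b : ℝ} (hab : chordSet Ω θ x = Ioo a b)
    (ha : a ≤ 0) (hb : 0 < b) : x + a • θ ∉ Ω := by
  intro hmem
  have ha' : a ∈ chordSet Ω θ x := by
    intro t ht
    rw [uIcc_of_ge ha] at ht
    rcases ht.1.eq_or_lt with rfl | hat
    · exact hmem
    · exact add_smul_mem_of_mem_chordSet (hab ▸ ⟨hat, ht.2.trans_lt hb⟩)
  exact (hab ▸ ha').1.false

end ChordSet

section ChordSetTopology

variable {V : Type*} [AddCommGroup V] [Module ℝ V] [TopologicalSpace V] [ContinuousAdd V]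
  [ContinuousSMul ℝ V] {Ω : Set V} {θ x : V}

theorem isOpen_setOf_mem_chordSet (hΩ : IsOpen Ω) (θ : V) :
    IsOpen {p : V × ℝ | p.2 ∈ chordSet Ω θ p.1} := by
  simp only [mem_chordSet_iff_forall_Icc, isOpen_iff_mem_nhds]
  intro p hp
  refine isCompact_Icc.eventually_forall_of_forall_eventually fun t ht => ?_
  have hcont : Continuous fun q : (V × ℝ) × ℝ => q.1.1 + (q.2 * q.1.2) • θ := by fun_prop
  exact hcont.continuousAt.eventually (hΩ.mem_nhds (hp t ht))

theorem isOpen_chordSet (hΩ : IsOpen Ω) (θ x : V) : IsOpen (chordSet Ω θ x) :=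
  (isOpen_setOf_mem_chordSet hΩ θ).preimage (f := fun s : ℝ => (x, s)) (by fun_prop)

theorem isOpen_setOf_mem_chordSet_left (hΩ : IsOpen Ω) (θ : V) (s : ℝ) :
    IsOpen {x | s ∈ chordSet Ω θ x} :=
  (isOpen_setOf_mem_chordSet hΩ θ).preimage (f := fun x : V => (x, s)) (by fun_prop)

theorem volume_chordSet_ne_zero (hΩ : IsOpen Ω) (hx : x ∈ Ω) : volume (chordSet Ω θ x) ≠ 0 :=
  ((isOpen_chordSet hΩ θ x).measure_pos _ ⟨0, zero_mem_chordSet hx⟩).ne'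

theorem exists_chordSet_eq_Ioo (hΩ : IsOpen Ω) (hbdd : Bornology.IsBounded (chordSet Ω θ x))
    (hx : x ∈ Ω) : ∃ a < 0, ∃ b > 0, chordSet Ω θ x = Ioo a b := by
  have hconn : IsConnected (chordSet Ω θ x) :=
    ⟨⟨0, zero_mem_chordSet hx⟩, (ordConnected_chordSet Ω θ x).isPreconnected⟩
  have hsub : chordSet Ω θ x ⊆ Ioo (sInf (chordSet Ω θ x)) (sSup (chordSet Ω θ x)) := by
    rw [← interior_Icc]
    exact interior_maximal (subset_Icc_csInf_csSup hbdd.bddBelow hbdd.bddAbove)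
      (isOpen_chordSet hΩ θ x)
  have h0 := hsub (zero_mem_chordSet hx)
  exact ⟨_, h0.1, _, h0.2,
    hsub.antisymm (hconn.Ioo_csInf_csSup_subset hbdd.bddBelow hbdd.bddAbove)⟩

end ChordSetTopology

section ChordSetNormed

variable {V : Type*} [NormedAddCommGroup V] [NormedSpace ℝ V] {Ω : Set V} {θ : V}

theorem isBounded_setOf_add_smul_mem (hb : Bornology.IsBounded Ω) (hθ : θ ≠ 0) (x : V) :
    Bornology.IsBounded {s : ℝ | x + s • θ ∈ Ω} := by
  obtain ⟨R, hR⟩ := hb.exists_norm_le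
  refine isBounded_iff_forall_norm_le.2 ⟨(R + ‖x‖) / ‖θ‖, fun s hs => ?_⟩
  rw [le_div_iff₀ (norm_pos_iff.2 hθ), ← norm_smul]
  calc ‖s • θ‖ = ‖x + s • θ - x‖ := by rw [add_sub_cancel_left]
    _ ≤ ‖x + s • θ‖ + ‖x‖ := norm_sub_le _ _
    _ ≤ R + ‖x‖ := by gcongr; exact hR _ hs

theorem isBounded_chordSet (hb : Bornology.IsBounded Ω) (hθ : θ ≠ 0) (x : V) :
    Bornology.IsBounded (chordSet Ω θ x) :=
  (isBounded_setOf_add_smul_mem hb hθ x).subset fun _ => add_smul_mem_of_mem_chordSet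

end ChordSetNormed

/-! ### Averages along chords -/

section ChordAvg

variable {V : Type*} [AddCommGroup V] [Module ℝ V] {F : Type*} [NormedAddCommGroup F]
  [NormedSpace ℝ F] {Ω : Set V} {θ x : V} {s : ℝ}

/-- The mean value of `G` on the chord of `Ω` through `x` in the direction `θ`; it is `0` if
`x ∉ Ω` or if the chord is infinite. -/
def chordAvg (Ω : Set V) (θ : V) (G : V → F) (x : V) : F :=
  ⨍ s in chordSet Ω θ x, G (x + s • θ)

/-- The density of the uniform distribution on `chordSet Ω θ p.1`, evaluated at `p.2`; averaging
along chords is integrating against this kernel. -/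
def chordWeight (Ω : Set V) (θ : V) : V × ℝ → ℝ :=
  {p | p.2 ∈ chordSet Ω θ p.1}.indicator fun p => (volume.real (chordSet Ω θ p.1))⁻¹

theorem chordAvg_eq_zero (G : V → F) (hx : x ∉ Ω) : chordAvg Ω θ G x = 0 := by
  simp [chordAvg, chordSet_eq_empty hx]

theorem chordAvg_add_smul (G : V → F) (hs : s ∈ chordSet Ω θ x) :
    chordAvg Ω θ G (x + s • θ) = chordAvg Ω θ G x := by
  rw [chordAvg, chordAvg, setAverage_eq, setAverage_eq, measureReal_def,
    volume_chordSet_add_smul hs, ← measureReal_def, chordSet_add_smul hs,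
    ← (measurePreserving_add_left volume s).setIntegral_preimage_emb
      (measurableEmbedding_addLeft s) _ (chordSet Ω θ x)]
  simp only [add_assoc, ← add_smul]

theorem chordWeight_nonneg (p : V × ℝ) : 0 ≤ chordWeight Ω θ p :=
  indicator_nonneg (fun _ _ => inv_nonneg.2 measureReal_nonneg) p

theorem chordWeight_section (Ω : Set V) (θ x : V) : (fun s => chordWeight Ω θ (x, s)) =
    (chordSet Ω θ x).indicator fun _ => (volume.real (chordSet Ω θ x))⁻¹ :=
  rfl

/-- The kernel is symmetric: `y` lies on the chord through `x` if and only if `x` lies on the chord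
through `y`, and these chords have the same length. -/
theorem chordWeight_shear (x : V) (s : ℝ) :
    chordWeight Ω θ (x + s • θ, -s) = chordWeight Ω θ (x, s) := by
  by_cases hs : s ∈ chordSet Ω θ x
  · simp [chordWeight, hs, neg_mem_chordSet hs, measureReal_def, volume_chordSet_add_smul hs]
  · simp [chordWeight, hs, neg_mem_chordSet_add_smul_iff]

theorem chordWeight_smul_indicator (G : V → F) (s : ℝ) :
    chordWeight Ω θ (x, s) • Ω.indicator G (x + s • θ) =
      chordWeight Ω θ (x, s) • G (x + s • θ) := by
  by_cases hs : s ∈ chordSet Ω θ x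
  · rw [indicator_of_mem (add_smul_mem_of_mem_chordSet hs)]
  · simp [chordWeight, hs]

end ChordAvg

section ChordAvgMeasure

variable {V : Type*} [AddCommGroup V] [Module ℝ V] [TopologicalSpace V] [ContinuousAdd V]
  [ContinuousSMul ℝ V] {F : Type*} [NormedAddCommGroup F] [NormedSpace ℝ F] {Ω : Set V} {θ x : V}

theorem chordAvg_eq_integral (hΩ : IsOpen Ω) (θ : V) (G : V → F) (x : V) :
    chordAvg Ω θ G x = ∫ s, chordWeight Ω θ (x, s) • G (x + s • θ) := by
  have hmeas := (isOpen_chordSet hΩ θ x).measurableSet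
  simp only [congrFun (chordWeight_section Ω θ x), ← indicator_smul_left]
  rw [integral_indicator hmeas, integral_smul, chordAvg, setAverage_eq]

theorem chordAvg_congr (hΩ : IsOpen Ω) {G H : V → F} (h : EqOn G H Ω) :
    chordAvg Ω θ G x = chordAvg Ω θ H x := by
  rw [chordAvg, chordAvg, setAverage_congr_fun (isOpen_chordSet hΩ θ x).measurableSet
    (.of_forall fun _ hs => h (add_smul_mem_of_mem_chordSet hs))]

theorem integrable_chordWeight_section (hΩ : IsOpen Ω) (hfin : volume (chordSet Ω θ x) ≠ ⊤) :
    Integrable fun s => chordWeight Ω θ (x, s) := by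
  rw [chordWeight_section, integrable_indicator_iff (isOpen_chordSet hΩ θ x).measurableSet]
  exact integrableOn_const hfin

theorem integral_chordWeight (hΩ : IsOpen Ω) (hfin : volume (chordSet Ω θ x) ≠ ⊤) (hx : x ∈ Ω) :
    ∫ s, chordWeight Ω θ (x, s) = 1 := by
  rw [chordWeight_section, integral_indicator (isOpen_chordSet hΩ θ x).measurableSet,
    setIntegral_const, smul_eq_mul, mul_inv_cancel₀]
  exact (ENNReal.toReal_pos (volume_chordSet_ne_zero hΩ hx) hfin).ne'

theorem integral_chordWeight_smul_indicator [CompleteSpace F] (hΩ : IsOpen Ω)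
    (hfin : volume (chordSet Ω θ x) ≠ ⊤) (G : V → F) :
    ∫ s, chordWeight Ω θ (x, s) • Ω.indicator G x = Ω.indicator G x := by
  by_cases hx : x ∈ Ω
  · rw [integral_smul_const, integral_chordWeight hΩ hfin hx, one_smul]
  · simp [hx]

variable [MeasurableSpace V] [BorelSpace V]

theorem measurable_chordWeight (hΩ : IsOpen Ω) (θ : V) : Measurable (chordWeight Ω θ) := by
  have hmeas := (isOpen_setOf_mem_chordSet hΩ θ).measurableSet
  exact ((measurable_measure_prodMk_left hmeas).ennreal_toReal.inv.comp measurable_fst).indicator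
    hmeas

theorem stronglyMeasurable_chordAvg (hΩ : IsOpen Ω) (θ : V) {G : V → F}
    (hG : StronglyMeasurable G) : StronglyMeasurable (chordAvg Ω θ G) := by
  have hcont : Continuous fun p : V × ℝ => p.1 + p.2 • θ := by fun_prop
  have hprod : StronglyMeasurable fun p : V × ℝ => chordWeight Ω θ p • G (p.1 + p.2 • θ) :=
    (measurable_chordWeight hΩ θ).stronglyMeasurable.smul (hG.comp_measurable hcont.measurable)
  simpa only [← chordAvg_eq_integral hΩ] using
    hprod.integral_prod_right' (ν := volume)

variable {μ : Measure V}

theorem integrable_chordWeight_smul (hΩ : IsOpen Ω)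
    (hfin : ∀ x, volume (chordSet Ω θ x) ≠ ⊤) {G : V → F} (hG : Integrable (Ω.indicator G) μ) :
    Integrable (fun p : V × ℝ => chordWeight Ω θ p • Ω.indicator G p.1) (μ.prod volume) := by
  have hmeas : AEStronglyMeasurable (fun p : V × ℝ => chordWeight Ω θ p • Ω.indicator G p.1)
      (μ.prod volume) :=
    (measurable_chordWeight hΩ θ).aestronglyMeasurable.smul hG.aestronglyMeasurable.comp_fst
  rw [integrable_prod_iff hmeas]
  refine ⟨.of_forall fun x =>
    (integrable_chordWeight_section hΩ (hfin x)).smul_const (Ω.indicator G x), ?_⟩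
  refine hG.norm.congr (.of_forall fun x => ?_)
  simp only [norm_smul, Real.norm_of_nonneg (chordWeight_nonneg _),
    norm_indicator_eq_indicator_norm]
  exact (integral_chordWeight_smul_indicator hΩ (hfin x) fun x => ‖G x‖).symm

variable [SecondCountableTopology V] [SFinite μ] [μ.IsAddRightInvariant]

variable (μ) in
theorem measurePreserving_add_smul_prod (θ : V) (ν : Measure ℝ) [SFinite ν] :
    MeasurePreserving (fun p : V × ℝ => (p.1 + p.2 • θ, p.2)) (μ.prod ν) (μ.prod ν) := by
  have hskew : MeasurePreserving (fun p : ℝ × V => (p.1, p.2 + p.1 • θ)) (ν.prod μ) (ν.prod μ) := by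
    refine (MeasurePreserving.id ν).skew_product (g := fun s x => x + s • θ) ?_ ?_
    · exact Continuous.measurable (by fun_prop)
    · exact .of_forall fun s => (measurePreserving_add_right μ (s • θ)).map_eq
  exact Measure.measurePreserving_swap.comp (hskew.comp Measure.measurePreserving_swap)

variable (μ) in
theorem measurePreserving_shear (θ : V) :
    MeasurePreserving (fun p : V × ℝ => (p.1 + p.2 • θ, -p.2)) (μ.prod volume)
      (μ.prod volume) :=
  ((MeasurePreserving.id μ).prod (Measure.measurePreserving_neg volume)).comp
    (measurePreserving_add_smul_prod μ θ volume)

theorem integrable_chordWeight_smul_add_smul (hΩ : IsOpen Ω)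
    (hfin : ∀ x, volume (chordSet Ω θ x) ≠ ⊤) {G : V → F} (hG : IntegrableOn G Ω μ) :
    Integrable (fun p : V × ℝ => chordWeight Ω θ p • G (p.1 + p.2 • θ)) (μ.prod volume) := by
  have hker := integrable_chordWeight_smul (θ := θ) hΩ hfin
    ((integrable_indicator_iff hΩ.measurableSet).2 hG)
  have hshear := (measurePreserving_shear μ θ).integrable_comp_of_integrable hker
  simpa only [Function.comp_def, chordWeight_shear, chordWeight_smul_indicator] using hshear

theorem integrable_chordAvg (hΩ : IsOpen Ω) (hfin : ∀ x, volume (chordSet Ω θ x) ≠ ⊤)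
    {G : V → F} (hG : IntegrableOn G Ω μ) : Integrable (chordAvg Ω θ G) μ := by
  simpa only [← chordAvg_eq_integral hΩ] using
    (integrable_chordWeight_smul_add_smul hΩ hfin hG).integral_prod_left

theorem setIntegral_chordAvg [CompleteSpace F] (hΩ : IsOpen Ω)
    (hfin : ∀ x, volume (chordSet Ω θ x) ≠ ⊤) {G : V → F} (hG : IntegrableOn G Ω μ) :
    ∫ x in Ω, chordAvg Ω θ G x ∂μ = ∫ x in Ω, G x ∂μ := by
  have hker := integrable_chordWeight_smul (θ := θ) hΩ hfin
    ((integrable_indicator_iff hΩ.measurableSet).2 hG)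
  have hshear := measurePreserving_shear μ θ
  calc ∫ x in Ω, chordAvg Ω θ G x ∂μ
      = ∫ x, chordAvg Ω θ G x ∂μ :=
        setIntegral_eq_integral_of_forall_compl_eq_zero fun x hx => chordAvg_eq_zero G hx
    _ = ∫ p, chordWeight Ω θ p • G (p.1 + p.2 • θ) ∂(μ.prod volume) := by
        simp only [chordAvg_eq_integral hΩ]
        exact (integral_prod _ (integrable_chordWeight_smul_add_smul hΩ hfin hG)).symm
    _ = ∫ p : V × ℝ, chordWeight Ω θ (p.1 + p.2 • θ, -p.2) • Ω.indicator G (p.1 + p.2 • θ)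
          ∂(μ.prod volume) := by
        simp only [chordWeight_shear, chordWeight_smul_indicator]
    _ = ∫ p, chordWeight Ω θ p • Ω.indicator G p.1 ∂(μ.prod volume) := by
        have hmap := integral_map hshear.measurable.aemeasurable
          (hshear.map_eq.symm ▸ hker.aestronglyMeasurable)
        rw [hshear.map_eq] at hmap
        exact hmap.symm
    _ = ∫ x in Ω, G x ∂μ := by
        rw [integral_prod _ hker, ← integral_indicator hΩ.measurableSet]
        simp only [integral_chordWeight_smul_indicator hΩ (hfin _)]

end ChordAvgMeasure

/-! ### Primitives along chords -/

theorem integral_mul_add_mul_of_primitive {f g : ℝ → ℝ} {a b c : ℝ} (A B : ℝ)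
    (hf : IntervalIntegrable f volume a b) (hg : IntervalIntegrable g volume a b)
    (hc : c ∈ uIcc a b) :
    ∫ r in a..b, ((A + ∫ t in c..r, f t) * g r + (B + ∫ t in c..r, g t) * f r) =
      (A + ∫ t in c..b, f t) * (B + ∫ t in c..b, g t) -
        (A + ∫ t in c..a, f t) * (B + ∫ t in c..a, g t) := by
  have habs : ∀ {f : ℝ → ℝ} (A : ℝ), IntervalIntegrable f volume a b →
      AbsolutelyContinuousOnInterval (fun r => A + ∫ t in c..r, f t) a b := fun A hf =>
    (LipschitzWith.const' (K := 0) A).lipschitzOnWith.absolutelyContinuousOnInterval.add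
      (hf.absolutelyContinuousOnInterval_intervalIntegral hc)
  rw [← (habs A hf).integral_deriv_mul_eq_sub (habs B hg)]
  refine intervalIntegral.integral_congr_ae ?_
  filter_upwards [hf.ae_hasDerivAt_integral, hg.ae_hasDerivAt_integral] with r hfr hgr hr
  have hr' := uIoc_subset_uIcc hr
  rw [((hfr hr' c hc).const_add A).deriv, ((hgr hr' c hc).const_add B).deriv]
  ring

section LinePrimitive

variable {V : Type*} [AddCommGroup V] [Module ℝ V] {Ω : Set V} {θ x : V} {f g v w : V → ℝ}

/-- The primitive of `w` along the line through `x` in the direction `θ`, as a function of the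
signed parameter `s`, with the value `f x` at `x`. -/
def linePrimitive (θ : V) (f w : V → ℝ) (x : V) (s : ℝ) : ℝ :=
  f x + ∫ t in 0..s, w (x + t • θ)

/-- On the chord of `Ω` through `x`, the function `f` agrees almost everywhere with the primitive of
`w` that takes the value `f x` at `x`. Since `f x` is a pointwise value, this depends on `f` itself
and not only on its class. -/
structure IsPrimitiveOnChord (Ω : Set V) (θ : V) (f w : V → ℝ) (x : V) : Prop where
  intervalIntegrable : ∀ a b, IntervalIntegrable (fun t => w (x + t • θ)) volume a b
  ae_eq : ∀ᵐ s : ℝ, s ∈ chordSet Ω θ x → f (x + s • θ) = linePrimitive θ f w x s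

theorem linePrimitive_neg (θ : V) (f w : V → ℝ) (x : V) (s : ℝ) :
    linePrimitive (-θ) f (-w) x s = linePrimitive θ f w x (-s) := by
  simp only [linePrimitive, Pi.neg_apply, intervalIntegral.integral_neg, smul_neg, ← neg_smul]
  rw [intervalIntegral.integral_comp_neg (fun t => w (x + t • θ)), neg_zero,
    ← intervalIntegral.integral_symm]

theorem continuous_linePrimitive
    (hw : ∀ a b, IntervalIntegrable (fun t => w (x + t • θ)) volume a b) (f : V → ℝ) :
    Continuous (linePrimitive θ f w x) :=
  continuous_const.add (intervalIntegral.continuous_primitive hw 0)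

theorem IsPrimitiveOnChord.setIntegral_chordSet {a b : ℝ} (hf : IsPrimitiveOnChord Ω θ f w x)
    (hg : IsPrimitiveOnChord Ω θ g v x) (hab : chordSet Ω θ x = Ioo a b) (ha : a ≤ 0) (hb : 0 ≤ b) :
    ∫ s in chordSet Ω θ x, (f (x + s • θ) * v (x + s • θ) + g (x + s • θ) * w (x + s • θ)) =
      linePrimitive θ f w x b * linePrimitive θ g v x b -
        linePrimitive θ f w x a * linePrimitive θ g v x a := by
  have hprim := integral_mul_add_mul_of_primitive (f x) (g x) (hf.intervalIntegrable a b)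
    (hg.intervalIntegrable a b) (c := 0) (by simp [uIcc_of_le (ha.trans hb), ha, hb])
  rw [linePrimitive, linePrimitive, linePrimitive, linePrimitive, ← hprim,
    intervalIntegral.integral_of_le (ha.trans hb), integral_Ioc_eq_integral_Ioo, hab]
  refine setIntegral_congr_ae measurableSet_Ioo ?_
  filter_upwards [hf.ae_eq, hg.ae_eq] with s hfs hgs hs
  rw [hfs (hab ▸ hs), hgs (hab ▸ hs), linePrimitive, linePrimitive]

end LinePrimitive

theorem linePrimitive_deriv {φ : ℝ → ℝ} (hφ : ContDiff ℝ 1 φ) (r s : ℝ) :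
    linePrimitive 1 φ (deriv φ) r s = φ (r + s) := by
  simp only [linePrimitive, smul_eq_mul, mul_one]
  rw [intervalIntegral.integral_comp_add_left (deriv φ), intervalIntegral.integral_deriv_eq_sub
    (fun x _ => hφ.differentiable one_ne_zero x)
    ((hφ.continuous_deriv le_rfl).intervalIntegrable _ _), add_zero, add_sub_cancel]

theorem isPrimitiveOnChord_deriv {φ : ℝ → ℝ} (hφ : ContDiff ℝ 1 φ) (S : Set ℝ) (r : ℝ) :
    IsPrimitiveOnChord S 1 φ (deriv φ) r where
  intervalIntegrable a b := by
    have := hφ.continuous_deriv le_rfl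
    exact Continuous.intervalIntegrable (by fun_prop) a b
  ae_eq := .of_forall fun s _ => by rw [linePrimitive_deriv hφ, smul_eq_mul, mul_one]

/-! ### Weak directional derivatives -/

section WeakDeriv

variable {V : Type*} [NormedAddCommGroup V] [NormedSpace ℝ V] {Ω : Set V} {θ : V} {φ : V → ℝ}

theorem exists_apply_add_smul_eq_zero (hc : HasCompactSupport φ) (hθ : θ ≠ 0) (x₀ : V) :
    ∃ R, ∀ x ∈ Metric.ball x₀ 1, ∀ r ∉ Metric.closedBall (0 : ℝ) R, φ (x + r • θ) = 0 := by
  obtain ⟨C, hC⟩ := hc.isCompact.isBounded.exists_norm_le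
  refine ⟨(C + (‖x₀‖ + 1)) / ‖θ‖, fun x hx r hr => ?_⟩
  refine image_eq_zero_of_notMem_tsupport fun hmem => hr ?_
  rw [mem_closedBall_zero_iff, le_div_iff₀ (norm_pos_iff.2 hθ), ← norm_smul]
  calc ‖r • θ‖ = ‖x + r • θ - x‖ := by rw [add_sub_cancel_left]
    _ ≤ ‖x + r • θ‖ + ‖x‖ := norm_sub_le _ _
    _ ≤ C + (‖x₀‖ + 1) := by
      gcongr
      · exact hC _ hmem
      · exact (norm_lt_of_mem_ball hx).le

theorem contDiff_integral_sub_smul {n : ℕ∞} (hφ : ContDiff ℝ n φ) (hc : HasCompactSupport φ)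
    (hθ : θ ≠ 0) (a b : ℝ) : ContDiff ℝ n fun x => ∫ t in a..b, φ (x - t • θ) := by
  wlog hab : a ≤ b generalizing a b
  · simp only [intervalIntegral.integral_symm b a]
    exact (this b a (le_of_not_ge hab)).neg
  refine contDiff_iff_contDiffAt.2 fun x₀ => ?_
  obtain ⟨R, hR⟩ := exists_apply_add_smul_eq_zero hc hθ x₀
  have hind : LocallyIntegrable ((Ioc a b).indicator fun _ => (1 : ℝ)) volume :=
    ((integrable_indicator_iff measurableSet_Ioc).2
      (integrableOn_const measure_Ioc_lt_top.ne)).locallyIntegrable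
  -- The integral is the value at `0` of the convolution of `r ↦ φ (x + r • θ)` with `𝟙_(a, b]`.
  have hconv := contDiffOn_convolution_right_with_param_comp
    (ContinuousLinearMap.mul ℝ ℝ) (s := Metric.ball x₀ 1) (v := fun _ : V => (0 : ℝ))
    contDiffOn_const (g := fun x r => φ (x + r • θ)) Metric.isOpen_ball
    (isCompact_closedBall (0 : ℝ) R) (fun x r hx hr => hR x hx r hr) hind
    (hφ.comp (f := fun p : V × ℝ => p.1 + p.2 • θ) (by fun_prop)).contDiffOn
  refine (hconv.contDiffAt (Metric.ball_mem_nhds x₀ one_pos)).congr_of_eventuallyEq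
    (.of_forall fun x => ?_)
  simp only [convolution, ContinuousLinearMap.mul_apply']
  rw [intervalIntegral.integral_of_le hab, ← integral_indicator measurableSet_Ioc]
  congr 1 with t
  by_cases ht : t ∈ Ioc a b <;> simp [ht, sub_eq_add_neg]

theorem fderiv_integral_sub_smul (hφ : ContDiff ℝ 1 φ) (hc : HasCompactSupport φ)
    (hθ : θ ≠ 0) (s : ℝ) (x : V) :
    fderiv ℝ (fun x => ∫ t in 0..s, φ (x - t • θ)) x θ = φ x - φ (x - s • θ) := by
  set q : ℝ → ℝ := fun t => φ (x + t • θ) with hq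
  have hqc : Continuous q := by have := hφ.continuous; fun_prop
  have hline : HasDerivAt (fun r : ℝ => x + r • θ) θ 0 := by
    simpa using ((hasDerivAt_id (0 : ℝ)).smul_const θ).const_add x
  have hchain := HasFDerivAt.comp_hasDerivAt_of_eq (0 : ℝ)
    ((contDiff_integral_sub_smul (n := 1) hφ hc hθ 0 s).differentiable one_ne_zero x).hasFDerivAt
    hline (by simp)
  have htranslate : (fun r : ℝ => ∫ t in 0..s, φ (x + r • θ - t • θ)) =
      fun r => (∫ t in 0..r, q t) - ∫ t in 0..(r - s), q t := by
    ext r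
    have hqr : (fun t : ℝ => φ (x + r • θ - t • θ)) = fun t => q (r - t) := by
      ext t; simp only [hq, sub_smul, add_sub]
    rw [hqr, intervalIntegral.integral_comp_sub_left q, sub_zero,
      intervalIntegral.integral_interval_sub_left] <;> exact hqc.intervalIntegrable _ _
  have hftc : HasDerivAt (fun r => (∫ t in 0..r, q t) - ∫ t in 0..(r - s), q t)
      (q 0 - q (0 - s)) 0 :=
    (hqc.integral_hasStrictDerivAt 0 0).hasDerivAt.sub
      ((hqc.integral_hasStrictDerivAt 0 (0 - s)).hasDerivAt.comp_sub_const 0 s)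
  rw [hchain.unique (htranslate ▸ hftc)]
  simp [hq, sub_eq_add_neg]

theorem isTestFunction_integral_sub_smul {s : ℝ}
    (hφ : IsTestFunction {x | s ∈ chordSet Ω θ x} φ) (hθ : θ ≠ 0) :
    IsTestFunction Ω fun x => ∫ t in 0..s, φ (x - t • θ) := by
  set K : Set V := (fun p : V × ℝ => p.1 + p.2 • θ) '' (tsupport φ ×ˢ uIcc 0 s)
  have hK : IsCompact K := (hφ.2.1.isCompact.prod isCompact_uIcc).image (by fun_prop)
  have hsupp : Function.support (fun x => ∫ t in 0..s, φ (x - t • θ)) ⊆ K := by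
    intro x hx
    by_contra hxK
    refine hx (intervalIntegral.integral_zero_ae (.of_forall fun t ht => ?_))
    refine image_eq_zero_of_notMem_tsupport fun hmem => hxK ?_
    exact ⟨(x - t • θ, t), ⟨hmem, uIoc_subset_uIcc ht⟩, by simp⟩
  have htsupp := closure_minimal hsupp hK.isClosed
  refine ⟨contDiff_integral_sub_smul hφ.1 hφ.2.1 hθ 0 s,
    hK.of_isClosed_subset isClosed_closure htsupp, htsupp.trans ?_⟩
  rintro _ ⟨⟨x, t⟩, ⟨hx, ht⟩, rfl⟩
  exact hφ.2.2 hx t ht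

variable [MeasurableSpace V] {μ : Measure V} {f w : V → ℝ}

/-- `w` is a weak derivative of `f` on `Ω` in the direction `θ`, for functions defined on the whole
space and integrated against `μ` over the whole space. -/
def HasWeakDerivAlong (Ω : Set V) (θ : V) (μ : Measure V) (f w : V → ℝ) : Prop :=
  ∀ φ : V → ℝ, IsTestFunction Ω φ → ∫ x, f x * fderiv ℝ φ x θ ∂μ = -∫ x, w x * φ x ∂μ

theorem HasWeakDerivAlong.neg (h : HasWeakDerivAlong Ω θ μ f w) :
    HasWeakDerivAlong Ω (-θ) μ f (-w) := by
  intro φ hφ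
  simp [integral_neg, h φ hφ]

variable [BorelSpace V]

theorem measurable_linePrimitive (hf : Measurable f) (hw : StronglyMeasurable w) (θ : V) :
    Measurable fun p : V × ℝ => linePrimitive θ f w p.1 p.2 := by
  have hscale : ∀ p : V × ℝ, linePrimitive θ f w p.1 p.2 =
      f p.1 + p.2 * ∫ t in (0 : ℝ)..1, w (p.1 + (t * p.2) • θ) := fun p => by
    rw [linePrimitive, ← smul_eq_mul p.2,
      intervalIntegral.smul_integral_comp_mul_right (fun t => w (p.1 + t • θ)), zero_mul, one_mul]
  have hcomp : StronglyMeasurable fun q : (V × ℝ) × ℝ => w (q.1.1 + (q.2 * q.1.2) • θ) :=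
    hw.comp_measurable (Continuous.measurable (by fun_prop))
  simp only [hscale, intervalIntegral.integral_of_le zero_le_one]
  exact (hf.comp measurable_fst).add (measurable_snd.mul hcomp.integral_prod_right'.measurable)

section SecondCountable

variable [SecondCountableTopology V] [SFinite μ] [μ.IsAddRightInvariant]

theorem integrable_comp_add_smul (hw : Integrable w μ) (θ : V) (ν : Measure ℝ)
    [IsFiniteMeasure ν] : Integrable (fun p : V × ℝ => w (p.1 + p.2 • θ)) (μ.prod ν) :=
  (measurePreserving_add_smul_prod μ θ ν).integrable_comp_of_integrable (hw.comp_fst ν)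

theorem integrable_integral_add_smul (hw : Integrable w μ) (θ : V) (a b : ℝ) :
    Integrable (fun x => ∫ t in a..b, w (x + t • θ)) μ :=
  (integrable_comp_add_smul hw θ (volume.restrict (Ioc a b))).integral_prod_left.sub
    (integrable_comp_add_smul hw θ (volume.restrict (Ioc b a))).integral_prod_left

theorem ae_intervalIntegrable_add_smul (hw : Integrable w μ) (θ : V) :
    ∀ᵐ x ∂μ, ∀ a b, IntervalIntegrable (fun t => w (x + t • θ)) volume a b := by
  have hnat : ∀ᵐ x ∂μ, ∀ n : ℕ,
      IntegrableOn (fun t => w (x + t • θ)) (Icc (-n : ℝ) n) :=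
    ae_all_iff.2 fun n =>
      (integrable_comp_add_smul hw θ (volume.restrict (Icc (-n : ℝ) n))).prod_right_ae
  filter_upwards [hnat] with x hx a b
  obtain ⟨n, hn⟩ := exists_nat_ge (max |a| |b|)
  refine (IntegrableOn.mono_set (hx n) ?_).intervalIntegrable
  exact uIcc_subset_Icc (abs_le.1 ((le_max_left _ _).trans hn))
    (abs_le.1 ((le_max_right _ _).trans hn))

theorem integral_mul_integral_sub_smul (hw : Integrable w μ) (hφ : Continuous φ)
    (hc : HasCompactSupport φ) (θ : V) (a b : ℝ) :
    ∫ x, w x * (∫ t in a..b, φ (x - t • θ)) ∂μ =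
      ∫ x, (∫ t in a..b, w (x + t • θ)) * φ x ∂μ := by
  obtain ⟨M, hM⟩ := hφ.bounded_above_of_compact_support hc
  have : IsFiniteMeasure ((volume : Measure ℝ).restrict (uIoc a b)) := by
    unfold uIoc; infer_instance
  have hleft : Integrable (fun p : ℝ × V => w p.2 * φ (p.2 - p.1 • θ))
      ((volume.restrict (uIoc a b)).prod μ) :=
    (hw.comp_snd _).mul_bdd (c := M) (Continuous.aestronglyMeasurable (by fun_prop))
      (.of_forall fun _ => hM _)
  have hright : Integrable (fun p : ℝ × V => w (p.2 + p.1 • θ) * φ p.2)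
      ((volume.restrict (uIoc a b)).prod μ) :=
    (integrable_comp_add_smul hw θ _).swap.mul_bdd (c := M)
      (Continuous.aestronglyMeasurable (by fun_prop)) (.of_forall fun _ => hM _)
  simp only [← intervalIntegral.integral_const_mul, ← intervalIntegral.integral_mul_const]
  rw [← intervalIntegral_integral_swap (f := fun t x => w x * φ (x - t • θ)) hleft,
    ← intervalIntegral_integral_swap (f := fun t x => w (x + t • θ) * φ x) hright]
  congr 1 with t
  rw [← integral_add_right_eq_self _ (t • θ)]
  simp

theorem integrable_linePrimitive (hf : Integrable f μ) (hw : Integrable w μ) (θ : V) (s : ℝ) :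
    Integrable (fun x => linePrimitive θ f w x s) μ :=
  hf.add (integrable_integral_add_smul hw θ 0 s)

theorem HasWeakDerivAlong.integral_increment_mul (h : HasWeakDerivAlong Ω θ μ f w) (hθ : θ ≠ 0)
    (hf : Integrable f μ) (hw : Integrable w μ) {s : ℝ}
    (hφ : IsTestFunction {x | s ∈ chordSet Ω θ x} φ) :
    ∫ x, φ x * (f (x + s • θ) - linePrimitive θ f w x s) ∂μ = 0 := by
  obtain ⟨M, hM⟩ := hφ.1.continuous.bounded_above_of_compact_support hφ.2.1
  have hmul : ∀ (y : V) {g : V → ℝ}, Integrable g μ → Integrable (fun x => g x * φ (x - y)) μ :=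
    fun y g hg => hg.mul_bdd (c := M)
      (hφ.1.continuous.comp (continuous_sub_right y)).aestronglyMeasurable
      (.of_forall fun _ => hM _)
  have hmul₀ : ∀ {g : V → ℝ}, Integrable g μ → Integrable (fun x => g x * φ x) μ :=
    fun hg => by simpa using hmul 0 hg
  have htranslate : ∫ x, f x * φ (x - s • θ) ∂μ = ∫ x, f (x + s • θ) * φ x ∂μ := by
    rw [← integral_add_right_eq_self _ (s • θ)]
    simp
  have hweak := h _ (isTestFunction_integral_sub_smul hφ hθ)
  simp only [fderiv_integral_sub_smul (hφ.1.of_le (by simp)) hφ.2.1 hθ, mul_sub] at hweak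
  rw [integral_sub (hmul₀ hf) (hmul _ hf), htranslate,
    integral_mul_integral_sub_smul hw hφ.1.continuous hφ.2.1] at hweak
  have hprim : ∫ x, linePrimitive θ f w x s * φ x ∂μ =
      ∫ x, f x * φ x ∂μ + ∫ x, (∫ t in 0..s, w (x + t • θ)) * φ x ∂μ := by
    simp only [linePrimitive, add_mul]
    exact integral_add (hmul₀ hf) (hmul₀ (integrable_integral_add_smul hw θ 0 s))
  simp only [mul_comm (φ _), sub_mul]
  rw [integral_sub (hmul₀ (hf.comp_add_right _)) (hmul₀ (integrable_linePrimitive hf hw θ s)),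
    hprim]
  linarith

end SecondCountable

variable [FiniteDimensional ℝ V] [SFinite μ] [μ.IsAddRightInvariant]

theorem HasWeakDerivAlong.ae_add_smul_eq_linePrimitive (h : HasWeakDerivAlong Ω θ μ f w)
    (hΩ : IsOpen Ω) (hθ : θ ≠ 0) (hf : Integrable f μ) (hw : Integrable w μ) (s : ℝ) :
    ∀ᵐ x ∂μ, s ∈ chordSet Ω θ x → f (x + s • θ) = linePrimitive θ f w x s := by
  have hint : Integrable (fun x => f (x + s • θ) - linePrimitive θ f w x s) μ :=
    (hf.comp_add_right _).sub (integrable_linePrimitive hf hw θ s)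
  have hzero := (isOpen_setOf_mem_chordSet_left hΩ θ s).ae_eq_zero_of_integral_contDiff_smul_eq_zero
    (hint.locallyIntegrable.locallyIntegrableOn _) fun φ hφ hc hsupp =>
      h.integral_increment_mul hθ hf hw ⟨hφ, hc, hsupp⟩
  filter_upwards [hzero] with x hx hs
  exact sub_eq_zero.1 (hx hs)

theorem HasWeakDerivAlong.ae_isPrimitiveOnChord (h : HasWeakDerivAlong Ω θ μ f w) (hΩ : IsOpen Ω)
    (hθ : θ ≠ 0) (hf : Integrable f μ) (hfm : Measurable f) (hw : Integrable w μ)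
    (hwm : StronglyMeasurable w) : ∀ᵐ x ∂μ, IsPrimitiveOnChord Ω θ f w x := by
  have hmeas : MeasurableSet {p : V × ℝ | p.2 ∈ chordSet Ω θ p.1 →
      f (p.1 + p.2 • θ) = linePrimitive θ f w p.1 p.2} := by
    have hcont : Continuous fun p : V × ℝ => p.1 + p.2 • θ := by fun_prop
    exact (isOpen_setOf_mem_chordSet hΩ θ).measurableSet.imp
      (measurableSet_eq_fun (hfm.comp hcont.measurable) (measurable_linePrimitive hfm hwm θ))
  have hae := (Measure.ae_ae_comm (μ := μ) (ν := volume) hmeas).2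
    (.of_forall (h.ae_add_smul_eq_linePrimitive hΩ hθ hf hw))
  filter_upwards [ae_intervalIntegrable_add_smul hw θ, hae] with x hint heq
  exact ⟨hint, heq⟩

end WeakDeriv

/-! ### Exit times -/

section ExitTime

variable {d : ℕ} {Ω : Set (E d)} {θ x : E d} {s : ℝ}

theorem chordSet_eq_Ioo (hΩ : IsOpen Ω) (hb : Bornology.IsBounded Ω) (hθ : θ ≠ 0) (hx : x ∈ Ω) :
    chordSet Ω θ x = Ioo (-exitTime Ω (-θ) x) (exitTime Ω θ x) := by
  obtain ⟨a, ha, b, hb0, hab⟩ := exists_chordSet_eq_Ioo hΩ (isBounded_chordSet hb hθ x) hx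
  have hmem : ∀ t ∈ Ioo a b, x + t • θ ∈ Ω := fun t ht => add_smul_mem_of_mem_chordSet (hab ▸ ht)
  have hright : exitTime Ω θ x = b :=
    exitTime_eq hb0.le (fun t ht => hmem t ⟨ha.trans_le ht.1, ht.2⟩)
      (add_smul_right_notMem_of_chordSet_eq_Ioo hab ha hb0.le)
  have hleft : exitTime Ω (-θ) x = -a := by
    refine exitTime_eq (neg_nonneg.2 ha.le) (fun t ht => ?_) ?_
    · rw [smul_neg, ← neg_smul]
      exact hmem _ ⟨by linarith [ht.2], by linarith [ht.1]⟩
    · rw [smul_neg, neg_smul, neg_neg]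
      exact add_smul_left_notMem_of_chordSet_eq_Ioo hab ha.le hb0
  rw [hright, hleft, neg_neg, hab]

theorem exitTime_pos (hΩ : IsOpen Ω) (hb : Bornology.IsBounded Ω) (hθ : θ ≠ 0) (hx : x ∈ Ω) :
    0 < exitTime Ω θ x :=
  ((chordSet_eq_Ioo hΩ hb hθ hx).subset (zero_mem_chordSet hx)).2

theorem exitTime_of_notMem (θ : E d) (hx : x ∉ Ω) : exitTime Ω θ x = 0 :=
  exitTime_eq le_rfl (by simp) (by simpa using hx)

theorem mem_chordSet_iff_lt_exitTime (hΩ : IsOpen Ω) (hb : Bornology.IsBounded Ω) (hθ : θ ≠ 0)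
    (hs : 0 ≤ s) : s ∈ chordSet Ω θ x ↔ s < exitTime Ω θ x := by
  by_cases hx : x ∈ Ω
  · have := exitTime_pos hΩ hb (neg_ne_zero.2 hθ) hx
    simp only [chordSet_eq_Ioo hΩ hb hθ hx, mem_Ioo, and_iff_right_iff_imp]
    intro
    linarith
  · simpa [chordSet_eq_empty hx, exitTime_of_notMem θ hx] using hs

theorem volume_real_chordSet (hΩ : IsOpen Ω) (hb : Bornology.IsBounded Ω) (hθ : θ ≠ 0)
    (hx : x ∈ Ω) : volume.real (chordSet Ω θ x) = exitTime Ω θ x + exitTime Ω (-θ) x := by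
  have hright := exitTime_pos hΩ hb hθ hx
  have hleft := exitTime_pos hΩ hb (neg_ne_zero.2 hθ) hx
  rw [chordSet_eq_Ioo hΩ hb hθ hx, Real.volume_real_Ioo_of_le (by linarith), sub_neg_eq_add]

theorem exitPoint_notMem (hΩ : IsOpen Ω) (hb : Bornology.IsBounded Ω) (hθ : θ ≠ 0) (hx : x ∈ Ω) :
    exitPoint Ω θ x ∉ Ω :=
  add_smul_right_notMem_of_chordSet_eq_Ioo (chordSet_eq_Ioo hΩ hb hθ hx)
    (neg_neg_of_pos (exitTime_pos hΩ hb (neg_ne_zero.2 hθ) hx)) (exitTime_pos hΩ hb hθ hx).le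

theorem exitPoint_mem_frontier (hΩ : IsOpen Ω) (hb : Bornology.IsBounded Ω) (hθ : θ ≠ 0)
    (hx : x ∈ Ω) : exitPoint Ω θ x ∈ frontier Ω := by
  have hpos := exitTime_pos hΩ hb hθ hx
  refine hΩ.frontier_eq ▸ ⟨?_, exitPoint_notMem hΩ hb hθ hx⟩
  refine map_mem_closure (f := fun t : ℝ => x + t • θ) (by fun_prop)
    (s := Ico 0 (exitTime Ω θ x)) (closure_Ico hpos.ne ▸ right_mem_Icc.2 hpos.le) fun t ht => ?_
  exact add_smul_mem_of_mem_chordSet ((mem_chordSet_iff_lt_exitTime hΩ hb hθ ht.1).2 ht.2)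

theorem exitTime_add_smul (hΩ : IsOpen Ω) (hb : Bornology.IsBounded Ω) (hθ : θ ≠ 0)
    (hs : s ∈ chordSet Ω θ x) : exitTime Ω θ (x + s • θ) = exitTime Ω θ x - s := by
  have hx := mem_of_mem_chordSet hs
  have hs' := hs
  rw [chordSet_eq_Ioo hΩ hb hθ hx] at hs'
  refine exitTime_eq (sub_nonneg.2 hs'.2.le) (fun t ht => ?_) ?_
  · refine add_smul_mem_of_mem_chordSet ((mem_chordSet_add_smul hs).2 ?_)
    rw [chordSet_eq_Ioo hΩ hb hθ hx]
    exact ⟨by linarith [hs'.1, ht.1], by linarith [ht.2]⟩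
  · rw [add_assoc, ← add_smul, add_sub_cancel]
    exact exitPoint_notMem hΩ hb hθ hx

theorem exitPoint_add_smul (hΩ : IsOpen Ω) (hb : Bornology.IsBounded Ω) (hθ : θ ≠ 0)
    (hs : s ∈ chordSet Ω θ x) : exitPoint Ω θ (x + s • θ) = exitPoint Ω θ x := by
  rw [exitPoint, exitPoint, exitTime_add_smul hΩ hb hθ hs]
  module

theorem measurable_exitTime (hΩ : IsOpen Ω) (hb : Bornology.IsBounded Ω) (hθ : θ ≠ 0) :
    Measurable (exitTime Ω θ) := by
  refine measurable_of_Ioi fun r => ?_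
  rcases lt_or_ge r 0 with hr | hr
  · have hnonneg : ∀ x, 0 ≤ exitTime Ω θ x := fun x => Real.sSup_nonneg fun _ hs => hs.1
    simp [preimage, hr.trans_le (hnonneg _)]
  · simpa only [preimage, mem_Ioi, mem_chordSet_iff_lt_exitTime hΩ hb hθ hr] using
      (isOpen_setOf_mem_chordSet_left hΩ θ r).measurableSet

theorem measurable_exitPoint (hΩ : IsOpen Ω) (hb : Bornology.IsBounded Ω) (hθ : θ ≠ 0) :
    Measurable (exitPoint Ω θ) :=
  measurable_id.add ((measurable_exitTime hΩ hb hθ).smul_const θ)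

end ExitTime

/-! ### Slicing in the direction of a unit vector -/

section HaarEquiv

variable {V W : Type*} [NormedAddCommGroup V] [NormedSpace ℝ V] [MeasurableSpace V] [BorelSpace V]
  [NormedAddCommGroup W] [NormedSpace ℝ W] [FiniteDimensional ℝ W] [MeasurableSpace W]
  [BorelSpace W] (e : V ≃L[ℝ] W) (μ : Measure V) [μ.IsAddHaarMeasure] (ν : Measure W)
  [ν.IsAddHaarMeasure]

theorem exists_map_continuousLinearEquiv_eq_smul : ∃ c : NNReal, μ.map e = c • ν :=
  ⟨_, Measure.isAddLeftInvariant_eq_smul _ _⟩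

theorem quasiMeasurePreserving_continuousLinearEquiv : Measure.QuasiMeasurePreserving e μ ν := by
  obtain ⟨c, hc⟩ := exists_map_continuousLinearEquiv_eq_smul e μ ν
  exact ⟨e.continuous.measurable, hc ▸ Measure.smul_absolutelyContinuous⟩

theorem integrable_comp_continuousLinearEquiv {f : W → ℝ} (hf : Integrable f ν) :
    Integrable (fun x => f (e x)) μ := by
  obtain ⟨c, hc⟩ := exists_map_continuousLinearEquiv_eq_smul e μ ν
  exact (hc ▸ hf.smul_measure_nnreal (c := c)).comp_measurable e.continuous.measurable

end HaarEquiv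

section Slice

variable {d : ℕ} {Ω : Set (E d)} {θ y : E d}

theorem inner_smul_add (hθ : ‖θ‖ = 1) (hy : ⟪y, θ⟫ = 0) (r : ℝ) : ⟪r • θ + y, θ⟫ = r := by
  rw [inner_add_left, real_inner_smul_left, real_inner_self_eq_norm_sq, hθ, hy, one_pow, mul_one,
    add_zero]

theorem inner_proj (hθ : ‖θ‖ = 1) (x : E d) : ⟪proj θ x, θ⟫ = 0 := by
  rw [proj, inner_sub_left, real_inner_smul_left, real_inner_self_eq_norm_sq, hθ, one_pow, mul_one,
    sub_self]

theorem inner_smul_add_proj (θ x : E d) : ⟪x, θ⟫ • θ + proj θ x = x := by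
  rw [proj, add_sub_cancel]

theorem proj_smul_add (hθ : ‖θ‖ = 1) (hy : ⟪y, θ⟫ = 0) (r : ℝ) : proj θ (r • θ + y) = y := by
  rw [proj, inner_smul_add hθ hy, add_sub_cancel_left]

theorem proj_add_smul (hθ : ‖θ‖ = 1) (x : E d) (r : ℝ) : proj θ (x + r • θ) = proj θ x := by
  rw [proj, proj, inner_add_left, real_inner_smul_left, real_inner_self_eq_norm_sq, hθ]
  module

/-- The isomorphism `(y, r) ↦ r • θ + y`, which turns statements about almost every point of `ℝ^d`
into statements about almost every line in the direction `θ`. -/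
def sliceEquiv (hθ : ‖θ‖ = 1) : ((ℝ ∙ θ)ᗮ × ℝ) ≃L[ℝ] E d :=
  LinearEquiv.toContinuousLinearEquiv
    { toFun := fun p => p.2 • θ + p.1
      map_add' := fun p q => by simp only [Prod.fst_add, Prod.snd_add, Submodule.coe_add]; module
      map_smul' := fun c p => by
        simp only [Prod.smul_fst, Prod.smul_snd, Submodule.coe_smul, smul_eq_mul, RingHom.id_apply]
        module
      invFun := fun x =>
        (⟨proj θ x, Submodule.mem_orthogonal_singleton_iff_inner_left.2 (inner_proj hθ x)⟩, ⟪x, θ⟫)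
      left_inv := fun p =>
        have hp := Submodule.mem_orthogonal_singleton_iff_inner_left.1 p.1.2
        Prod.ext (Subtype.ext (proj_smul_add hθ hp _)) (inner_smul_add hθ hp _)
      right_inv := inner_smul_add_proj θ }

theorem ae_hyperplaneMeasure_iff {p : E d → Prop} : (∀ᵐ y ∂(hyperplaneMeasure θ), p y) ↔
    ∀ᵐ y : (ℝ ∙ θ)ᗮ ∂((stdOrthonormalBasis ℝ (ℝ ∙ θ)ᗮ).toBasis.addHaar), p y :=
  (MeasurableEmbedding.subtype_coe
    (Submodule.closed_of_finiteDimensional _).measurableSet).ae_map_iff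

theorem ae_hyperplane_ae_of_ae (hθ : ‖θ‖ = 1) {p : E d → Prop} (h : ∀ᵐ x, p x) :
    ∀ᵐ y ∂(hyperplaneMeasure θ), ∀ᵐ r : ℝ, p (r • θ + y) :=
  ae_hyperplaneMeasure_iff.2 <| Measure.ae_ae_of_ae_prod <|
    (quasiMeasurePreserving_continuousLinearEquiv (sliceEquiv hθ) _ volume).ae h

theorem ae_proj_of_ae_hyperplane (hθ : ‖θ‖ = 1) {p : E d → Prop}
    (h : ∀ᵐ y ∂(hyperplaneMeasure θ), p y) : ∀ᵐ x : E d, p (proj θ x) :=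
  (Measure.quasiMeasurePreserving_fst.comp
    (quasiMeasurePreserving_continuousLinearEquiv (sliceEquiv hθ).symm volume
      ((stdOrthonormalBasis ℝ (ℝ ∙ θ)ᗮ).toBasis.addHaar.prod volume))).ae
    (ae_hyperplaneMeasure_iff.1 h)

theorem ae_hyperplane_memLp_two (hθ : ‖θ‖ = 1) {f : E d → ℝ} (hfm : Measurable f)
    (hf : MemLp f 2) : ∀ᵐ y ∂(hyperplaneMeasure θ), MemLp (fun r : ℝ => f (r • θ + y)) 2 := by
  rw [ae_hyperplaneMeasure_iff]
  filter_upwards [(integrable_comp_continuousLinearEquiv (sliceEquiv hθ) (.prod _ volume) volume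
    hf.integrable_sq).prod_right_ae] with y hy
  have hmeas : Measurable fun r : ℝ => f (r • θ + y) :=
    hfm.comp (Continuous.measurable (by fun_prop))
  exact (memLp_two_iff_integrable_sq hmeas.aestronglyMeasurable).2 hy

theorem isOpen_slice (hΩ : IsOpen Ω) (θ y : E d) : IsOpen (slice Ω θ y) :=
  hΩ.preimage (f := fun s : ℝ => s • θ + y) (by fun_prop)

theorem isBounded_slice (hb : Bornology.IsBounded Ω) (hθ : θ ≠ 0) (y : E d) :
    Bornology.IsBounded (slice Ω θ y) := by
  simpa only [slice, add_comm] using isBounded_setOf_add_smul_mem hb hθ y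

theorem smul_add_add_smul (θ y : E d) (r t : ℝ) :
    r • θ + y + t • θ = (r + t • (1 : ℝ)) • θ + y := by
  rw [smul_eq_mul, mul_one]
  module

theorem chordSet_slice (Ω : Set (E d)) (θ y : E d) (r : ℝ) :
    chordSet (slice Ω θ y) 1 r = chordSet Ω θ (r • θ + y) := by
  simp only [chordSet, slice, mem_ofPred_eq, smul_add_add_smul]

theorem IsPrimitiveOnChord.slice {f w : E d → ℝ} {r : ℝ}
    (h : IsPrimitiveOnChord Ω θ f w (r • θ + y)) :
    IsPrimitiveOnChord (slice Ω θ y) 1 (fun s => f (s • θ + y)) (fun s => w (s • θ + y)) r where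
  intervalIntegrable := by
    simpa only [smul_add_add_smul] using h.intervalIntegrable
  ae_eq := by
    simpa only [chordSet_slice, linePrimitive, smul_add_add_smul] using h.ae_eq

end Slice

section ComponentInterval

variable {S : Set ℝ} {α β r : ℝ}

theorem IsComponentInterval.chordSet_eq (h : IsComponentInterval S α β) (hr : r ∈ Ioo α β) :
    chordSet S 1 r = Ioo (α - r) (β - r) := by
  obtain ⟨-, hsub, hα, hβ⟩ := h
  refine Subset.antisymm (fun s hs => ⟨?_, ?_⟩) fun s hs t ht => ?_
  · by_contra! hc
    exact hα (by simpa using hs (α - r) (mem_uIcc.2 (.inr ⟨hc, by linarith [hr.1]⟩)))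
  · by_contra! hc
    exact hβ (by simpa using hs (β - r) (mem_uIcc.2 (.inl ⟨by linarith [hr.2], hc⟩)))
  · have h0 : (0 : ℝ) ∈ Ioo (α - r) (β - r) := ⟨by linarith [hr.1], by linarith [hr.2]⟩
    have hmem := ordConnected_Ioo.uIcc_subset h0 hs ht
    exact hsub ⟨by simpa using sub_lt_iff_lt_add'.1 hmem.1,
      by simpa using lt_sub_iff_add_lt'.1 hmem.2⟩

theorem isComponentInterval_of_chordSet_eq {a b : ℝ} (h : chordSet S 1 r = Ioo a b) (ha : a < 0)
    (hb : 0 < b) : IsComponentInterval S (r + a) (r + b) := by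
  refine ⟨by linarith, fun s hs => ?_, ?_, ?_⟩
  · have hmem : s - r ∈ chordSet S 1 r := h ▸ ⟨by linarith [hs.1], by linarith [hs.2]⟩
    simpa using add_smul_mem_of_mem_chordSet hmem
  · simpa using add_smul_left_notMem_of_chordSet_eq_Ioo h ha.le hb
  · simpa using add_smul_right_notMem_of_chordSet_eq_Ioo h ha hb.le

theorem IsComponentInterval.left_unique {α' : ℝ} (h : IsComponentInterval S α β)
    (h' : IsComponentInterval S α' β) : α = α' := by
  refine le_antisymm ?_ ?_ <;> by_contra! hlt
  · exact h.2.2.1 (h'.2.1 ⟨hlt, h.1⟩)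
  · exact h'.2.2.1 (h.2.1 ⟨hlt, h'.1⟩)

end ComponentInterval

theorem isComponentInterval_slice {d : ℕ} {Ω : Set (E d)} {θ x : E d} (hΩ : IsOpen Ω)
    (hb : Bornology.IsBounded Ω) (hθ : θ ≠ 0) (hx : x ∈ Ω) :
    IsComponentInterval (slice Ω θ (proj θ x)) (⟪x, θ⟫ - exitTime Ω (-θ) x)
      (⟪x, θ⟫ + exitTime Ω θ x) := by
  rw [sub_eq_add_neg]
  refine isComponentInterval_of_chordSet_eq ?_
    (neg_neg_of_pos (exitTime_pos hΩ hb (neg_ne_zero.2 hθ) hx)) (exitTime_pos hΩ hb hθ hx)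
  rw [chordSet_slice, inner_smul_add_proj, chordSet_eq_Ioo hΩ hb hθ hx]

/-! ### Functions that are primitives along almost every chord -/

section MemH1

variable {S : Set ℝ} {f w φ : ℝ → ℝ} {r : ℝ}

theorem IsPrimitiveOnChord.chordAvg_testFunction_eq_zero (h : IsPrimitiveOnChord S 1 f w r)
    (hS : IsOpen S) (hb : Bornology.IsBounded S) (hφ : IsTestFunction S φ) :
    chordAvg S 1 (fun s => f s * deriv φ s + φ s * w s) r = 0 := by
  by_cases hr : r ∈ S
  swap; · exact chordAvg_eq_zero _ hr
  obtain ⟨a, ha, b, hb0, hab⟩ := exists_chordSet_eq_Ioo hS (isBounded_chordSet hb one_ne_zero r) hr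
  have hφ1 : ContDiff ℝ 1 φ := hφ.1.of_le (by simp)
  have hvanish : ∀ c : ℝ, r + c • (1 : ℝ) ∉ S → linePrimitive 1 φ (deriv φ) r c = 0 := by
    intro c hc
    rw [linePrimitive_deriv hφ1]
    exact image_eq_zero_of_notMem_tsupport fun hmem => hc (by simpa using hφ.2.2 hmem)
  rw [chordAvg, setAverage_eq,
    h.setIntegral_chordSet (isPrimitiveOnChord_deriv hφ1 S r) hab ha.le hb0.le,
    hvanish a (add_smul_left_notMem_of_chordSet_eq_Ioo hab ha.le hb0),
    hvanish b (add_smul_right_notMem_of_chordSet_eq_Ioo hab ha hb0.le), mul_zero, mul_zero,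
    sub_zero, smul_zero]

theorem memH1_of_ae_isPrimitiveOnChord (hS : IsOpen S) (hb : Bornology.IsBounded S)
    (hf : MemLp f 2 (volume.restrict S)) (hw : MemLp w 2 (volume.restrict S))
    (h : ∀ᵐ r, IsPrimitiveOnChord S 1 f w r) : MemH1 S f := by
  refine ⟨hf, w, hw, fun φ hφ => ?_⟩
  have hφ2 : MemLp φ 2 (volume.restrict S) :=
    (hφ.1.continuous.memLp_of_hasCompactSupport hφ.2.1).restrict S
  have hdφ2 : MemLp (deriv φ) 2 (volume.restrict S) :=
    ((hφ.1.continuous_deriv (by simp)).memLp_of_hasCompactSupport hφ.2.1.deriv).restrict S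
  have hfdφ : IntegrableOn (fun s => f s * deriv φ s) S := hf.integrable_mul hdφ2
  have hφw : IntegrableOn (fun s => φ s * w s) S := hφ2.integrable_mul hw
  have hfin : ∀ r, volume (chordSet S 1 r) ≠ ⊤ := fun r =>
    (isBounded_chordSet hb one_ne_zero r).measure_lt_top.ne
  have havg := setIntegral_chordAvg (θ := 1) hS hfin (hfdφ.add hφw)
  have hzero : chordAvg S 1 (fun s => f s * deriv φ s + φ s * w s) =ᵐ[volume.restrict S] 0 :=
    ae_restrict_of_ae (h.mono fun r hr => hr.chordAvg_testFunction_eq_zero hS hb hφ)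
  simp only [Pi.add_def] at havg
  rw [integral_congr_ae hzero, integral_zero', integral_add hfdφ hφw] at havg
  simp only [mul_comm (w _)]
  linarith

end MemH1

section EndValue

variable {f f₁ f₂ w : ℝ → ℝ} {α β c c₁ c₂ : ℝ}

/-- The value at `β` of the representative of `f` on `(α, β)` that is continuous on `(α, β]` is `c`.
This is the condition that `dirTrace` imposes on each chord. -/
def HasEndValue (f : ℝ → ℝ) (α β c : ℝ) : Prop :=
  ∃ h : ℝ → ℝ, h =ᵐ[volume.restrict (Ioo α β)] f ∧ ContinuousOn h (Ioc α β) ∧ c = h β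

theorem HasEndValue.unique (hαβ : α < β) (h₁ : HasEndValue f α β c₁) (h₂ : HasEndValue f α β c₂) :
    c₁ = c₂ := by
  obtain ⟨k₁, hf₁, hk₁, rfl⟩ := h₁
  obtain ⟨k₂, hf₂, hk₂, rfl⟩ := h₂
  have hae := hf₁.trans hf₂.symm
  rw [Measure.restrict_congr_set Ioo_ae_eq_Ioc] at hae
  exact Measure.eqOn_Ioc_of_ae_eq volume hae hk₁ hk₂ (right_mem_Ioc.2 hαβ)

theorem HasEndValue.congr_ae (h : HasEndValue f₁ α β c)
    (hae : f₁ =ᵐ[volume.restrict (Ioo α β)] f₂) : HasEndValue f₂ α β c :=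
  h.imp fun _ hk => ⟨hk.1.trans hae, hk.2⟩

theorem IsPrimitiveOnChord.hasEndValue {S : Set ℝ} {r : ℝ} (h : IsPrimitiveOnChord S 1 f w r)
    (hI : IsComponentInterval S α β) (hr : r ∈ Ioo α β) :
    HasEndValue f α β (linePrimitive 1 f w r (β - r)) := by
  refine ⟨fun s => linePrimitive 1 f w r (s - r), ?_,
    ((continuous_linePrimitive h.intervalIntegrable f).comp (by fun_prop)).continuousOn, rfl⟩
  rw [Filter.EventuallyEq, ae_restrict_iff' measurableSet_Ioo]
  filter_upwards [(measurePreserving_sub_right volume r).quasiMeasurePreserving.ae h.ae_eq]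
    with s hs hsI
  rw [← hs (hI.chordSet_eq hr ▸ ⟨by linarith [hsI.1], by linarith [hsI.2]⟩), smul_eq_mul, mul_one,
    add_sub_cancel]

theorem exists_hasEndValue_of_ae_isPrimitiveOnChord {S : Set ℝ}
    (h : ∀ᵐ r, IsPrimitiveOnChord S 1 f w r) (hI : IsComponentInterval S α β) :
    ∃ c, HasEndValue f α β c := by
  have hpos : volume (Ioo α β) ≠ 0 := ((Measure.measure_Ioo_pos volume).2 hI.1).ne'
  obtain ⟨r, hr, hprim⟩ := (frequently_ae_mem_iff.2 hpos).and_eventually h |>.exists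
  exact ⟨_, hprim.hasEndValue hI hr⟩

end EndValue

/-! ### Directional traces -/

section Trace

variable {d : ℕ} {Ω : Set (E d)} {θ : E d} {f w : E d → ℝ}

theorem exists_forall_hasEndValue_eq (hθ : ‖θ‖ = 1) (Ω : Set (E d)) (f : E d → ℝ) :
    ∃ g : E d → ℝ, ∀ y, ⟪y, θ⟫ = 0 → ∀ α β c, IsComponentInterval (slice Ω θ y) α β →
      HasEndValue (fun s => f (s • θ + y)) α β c → g (β • θ + y) = c := by
  classical
  let IsEnd (z : E d) (c : ℝ) : Prop := ∃ α, IsComponentInterval (slice Ω θ (proj θ z)) α ⟪z, θ⟫ ∧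
    HasEndValue (fun s => f (s • θ + proj θ z)) α ⟪z, θ⟫ c
  refine ⟨fun z => if h : ∃ c, IsEnd z c then h.choose else 0, fun y hy α β c hI hc => ?_⟩
  have hend : ∃ c', IsEnd (β • θ + y) c' := by
    refine ⟨c, α, ?_⟩
    rw [proj_smul_add hθ hy, inner_smul_add hθ hy]
    exact ⟨hI, hc⟩
  obtain ⟨α', hI', hc'⟩ := hend.choose_spec
  rw [proj_smul_add hθ hy, inner_smul_add hθ hy] at hI' hc'
  obtain rfl := hI.left_unique hI'
  simpa only [dif_pos hend] using hc'.unique hI.1 hc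

theorem dirTrace_nonempty (hΩ : IsOpen Ω) (hb : Bornology.IsBounded Ω) (hθ : ‖θ‖ = 1) {u : L2 Ω}
    (hfu : f =ᵐ[volume.restrict Ω] u) (hfm : Measurable f) (hwm : Measurable w)
    (hf : MemLp f 2) (hw : MemLp w 2) (hfw : ∀ᵐ x, IsPrimitiveOnChord Ω θ f w x) :
    (dirTrace Ω θ u).Nonempty := by
  have hθ0 : θ ≠ 0 := norm_ne_zero_iff.1 (hθ ▸ one_ne_zero)
  obtain ⟨g, hg⟩ := exists_forall_hasEndValue_eq hθ Ω f
  have hlines : ∀ᵐ y ∂(hyperplaneMeasure θ), MemH1 (slice Ω θ y) (fun s => f (s • θ + y)) ∧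
      ∀ᵐ r : ℝ, IsPrimitiveOnChord Ω θ f w (r • θ + y) := by
    filter_upwards [ae_hyperplane_memLp_two hθ hfm hf, ae_hyperplane_memLp_two hθ hwm hw,
      ae_hyperplane_ae_of_ae hθ hfw] with y hfy hwy hprim
    exact ⟨memH1_of_ae_isPrimitiveOnChord (isOpen_slice hΩ θ y) (isBounded_slice hb hθ0 y)
      (hfy.restrict _) (hwy.restrict _) (hprim.mono fun _ h => h.slice), hprim⟩
  refine ⟨g, f, hfu, {y ∈ proj θ '' Ω | MemH1 (slice Ω θ y) (fun s => f (s • θ + y)) ∧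
    ∀ᵐ r : ℝ, IsPrimitiveOnChord Ω θ f w (r • θ + y)}, sep_subset _ _,
    measure_mono_null (fun y hy hgood => hy.2 ⟨hy.1, hgood⟩) (ae_iff.1 hlines), ?_⟩
  rintro y ⟨⟨x, -, rfl⟩, hH1, hprim⟩
  refine ⟨hH1, fun α β hI => ?_⟩
  obtain ⟨c, hc⟩ := exists_hasEndValue_of_ae_isPrimitiveOnChord (hprim.mono fun _ h => h.slice) hI
  exact hg _ (inner_proj hθ x) α β c hI hc ▸ hc

theorem ae_hasEndValue_of_mem_dirTrace (hΩ : IsOpen Ω) (hθ : ‖θ‖ = 1)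
    {u : L2 Ω} (hfu : f =ᵐ[volume.restrict Ω] u) {g : E d → ℝ} (hg : g ∈ dirTrace Ω θ u) :
    ∀ᵐ y ∂(hyperplaneMeasure θ), y ∈ proj θ '' Ω → ∀ α β,
      IsComponentInterval (slice Ω θ y) α β →
        HasEndValue (fun s => f (s • θ + y)) α β (g (β • θ + y)) := by
  obtain ⟨f', hf'u, A, -, hnull, hA⟩ := hg
  have hA_ae : ∀ᵐ y ∂(hyperplaneMeasure θ), y ∈ proj θ '' Ω → y ∈ A := by
    rw [ae_iff]
    exact measure_mono_null (fun y hy => by rwa [mem_ofPred_eq, Classical.not_imp] at hy) hnull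
  have hff' := (ae_restrict_iff' hΩ.measurableSet).1 (hf'u.trans hfu.symm)
  filter_upwards [hA_ae, ae_hyperplane_ae_of_ae hθ hff'] with y hyA hline hy α β hI
  refine HasEndValue.congr_ae ((hA y (hyA hy)).2 α β hI) ?_
  rw [Filter.EventuallyEq, ae_restrict_iff' measurableSet_Ioo]
  exact hline.mono fun s hs hsI => hs (hI.2.1 hsI)

theorem ae_dirTrace_exitPoint (hΩ : IsOpen Ω) (hb : Bornology.IsBounded Ω) (hθ : ‖θ‖ = 1)
    {u : L2 Ω} (hfu : f =ᵐ[volume.restrict Ω] u) (hfw : ∀ᵐ x, IsPrimitiveOnChord Ω θ f w x)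
    {g : E d → ℝ} (hg : g ∈ dirTrace Ω θ u) :
    ∀ᵐ x, x ∈ Ω → g (exitPoint Ω θ x) = linePrimitive θ f w x (exitTime Ω θ x) := by
  have hθ0 : θ ≠ 0 := norm_ne_zero_iff.1 (hθ ▸ one_ne_zero)
  filter_upwards [hfw, ae_proj_of_ae_hyperplane hθ (ae_hasEndValue_of_mem_dirTrace hΩ hθ hfu hg)]
    with x hprim hend hx
  have hI := isComponentInterval_slice hΩ hb hθ0 hx
  have hmem : ⟪x, θ⟫ ∈ Ioo (⟪x, θ⟫ - exitTime Ω (-θ) x) (⟪x, θ⟫ + exitTime Ω θ x) :=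
    ⟨by linarith [exitTime_pos hΩ hb (neg_ne_zero.2 hθ0) hx],
      by linarith [exitTime_pos hΩ hb hθ0 hx]⟩
  have hslice := IsPrimitiveOnChord.slice (Ω := Ω) (θ := θ) (f := f) (w := w)
    (y := proj θ x) (r := ⟪x, θ⟫) (by rwa [inner_smul_add_proj])
  have heq := (hend ⟨x, hx, rfl⟩ _ _ hI).unique hI.1 (hslice.hasEndValue hI hmem)
  have hexit : (⟪x, θ⟫ + exitTime Ω θ x) • θ + proj θ x = exitPoint Ω θ x := by
    rw [proj, exitPoint]; module
  rw [hexit, add_sub_cancel_left] at heq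
  simpa only [linePrimitive, ← smul_add_add_smul, inner_smul_add_proj] using heq

end Trace

/-! ### The directional measure -/

section DirMeasure

variable {d : ℕ} {Ω : Set (E d)} {θ x z : E d}

theorem exitTime_sub_mem_chordSet (hΩ : IsOpen Ω) (hb : Bornology.IsBounded Ω) (hθ : θ ≠ 0)
    {r : ℝ} (hr : 0 < r) (hr' : r < exitTime Ω θ x) : exitTime Ω θ x - r ∈ chordSet Ω θ x :=
  (mem_chordSet_iff_lt_exitTime hΩ hb hθ (sub_nonneg.2 hr'.le)).2 (sub_lt_self _ hr)

theorem exitPoint_sub_smul (Ω : Set (E d)) (θ x : E d) (r : ℝ) :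
    exitPoint Ω θ x - r • θ = x + (exitTime Ω θ x - r) • θ := by
  rw [exitPoint]
  module

theorem mem_image_exitPoint_iff (hΩ : IsOpen Ω) (hb : Bornology.IsBounded Ω) (hθ : θ ≠ 0) :
    z ∈ exitPoint Ω θ '' Ω ↔ ∃ n : ℕ, z - (1 / ((n : ℝ) + 1)) • θ ∈ Ω ∧
      exitTime Ω θ (z - (1 / ((n : ℝ) + 1)) • θ) = 1 / ((n : ℝ) + 1) := by
  constructor
  · rintro ⟨x, hx, rfl⟩
    obtain ⟨n, hn⟩ := exists_nat_one_div_lt (exitTime_pos hΩ hb hθ hx)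
    have hmem := exitTime_sub_mem_chordSet hΩ hb hθ Nat.one_div_pos_of_nat hn
    refine ⟨n, ?_⟩
    rw [exitPoint_sub_smul, exitTime_add_smul hΩ hb hθ hmem, sub_sub_cancel]
    exact ⟨add_smul_mem_of_mem_chordSet hmem, rfl⟩
  · rintro ⟨n, hmem, htime⟩
    exact ⟨_, hmem, by rw [exitPoint, htime, sub_add_cancel]⟩

theorem measurableSet_image_exitPoint (hΩ : IsOpen Ω) (hb : Bornology.IsBounded Ω) (hθ : θ ≠ 0) :
    MeasurableSet (exitPoint Ω θ '' Ω) := by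
  have himage : exitPoint Ω θ '' Ω = ⋃ n : ℕ, {z | z - (1 / ((n : ℝ) + 1)) • θ ∈ Ω ∧
      exitTime Ω θ (z - (1 / ((n : ℝ) + 1)) • θ) = 1 / ((n : ℝ) + 1)} :=
    Set.ext fun z => by rw [mem_image_exitPoint_iff hΩ hb hθ, mem_iUnion]; rfl
  rw [himage]
  refine MeasurableSet.iUnion fun n => ?_
  have hshift : Measurable fun z : E d => z - (1 / ((n : ℝ) + 1)) • θ := by fun_prop
  exact (hshift hΩ.measurableSet).inter
    (measurableSet_eq_fun ((measurable_exitTime hΩ hb hθ).comp hshift) measurable_const)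

theorem ae_dirMeasure_mem_image_exitPoint (hΩ : IsOpen Ω) (hb : Bornology.IsBounded Ω)
    (hθ : θ ≠ 0) : ∀ᵐ z ∂(dirMeasure Ω θ), z ∈ exitPoint Ω θ '' Ω :=
  (ae_map_iff (measurable_exitPoint hΩ hb hθ).aemeasurable
    (measurableSet_image_exitPoint hΩ hb hθ)).2
    ((ae_restrict_mem hΩ.measurableSet).mono fun _ => mem_image_of_mem _)

theorem restrict_frontier_dirMeasure (hΩ : IsOpen Ω) (hb : Bornology.IsBounded Ω) (hθ : θ ≠ 0) :
    (dirMeasure Ω θ).restrict (frontier Ω) = dirMeasure Ω θ :=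
  Measure.restrict_eq_self_of_ae_mem <|
    (ae_dirMeasure_mem_image_exitPoint hΩ hb hθ).mono fun _ ⟨_, hx, hxz⟩ =>
      hxz ▸ exitPoint_mem_frontier hΩ hb hθ hx

theorem ae_dirMeasure_proj (hΩ : IsOpen Ω) (hb : Bornology.IsBounded Ω) (hθ : ‖θ‖ = 1)
    {p : E d → Prop} (h : ∀ᵐ y ∂(hyperplaneMeasure θ), p y) :
    ∀ᵐ z ∂(dirMeasure Ω θ), p (proj θ z) := by
  obtain ⟨N, hN, hNm, hN0⟩ := exists_measurable_superset_of_null (ae_iff.1 h)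
  have hproj : Measurable (proj θ : E d → E d) :=
    Continuous.measurable (by unfold proj; fun_prop)
  have hNc : ∀ᵐ z ∂(dirMeasure Ω θ), proj θ z ∈ Nᶜ := by
    rw [dirMeasure, ae_map_iff (aemeasurable_exitPoint hΩ hb hθ) (hproj hNm.compl)]
    refine ae_restrict_of_ae ?_
    filter_upwards [ae_proj_of_ae_hyperplane hθ (measure_eq_zero_iff_ae_notMem.1 hN0)] with x hx
    rwa [exitPoint, proj_add_smul hθ]
  exact hNc.mono fun z hz => not_not.1 fun hpz => hz (hN hpz)

theorem forall_exitPoint_of_ae_line (hΩ : IsOpen Ω) (hb : Bornology.IsBounded Ω) (hθ : θ ≠ 0)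
    {p : E d → Prop} (h : ∀ᵐ r : ℝ, r • θ + proj θ x ∈ Ω → p (exitPoint Ω θ (r • θ + proj θ x)))
    (hx : x ∈ Ω) : p (exitPoint Ω θ x) := by
  have hshift := (measurePreserving_add_right volume ⟪x, θ⟫).quasiMeasurePreserving.ae h
  obtain ⟨s, hs, hps⟩ := Measure.exists_mem_of_measure_ne_zero_of_ae (volume_chordSet_ne_zero hΩ hx)
    (ae_restrict_of_ae hshift)
  have hline : (s + ⟪x, θ⟫) • θ + proj θ x = x + s • θ := by rw [proj]; module
  rw [hline, exitPoint_add_smul hΩ hb hθ hs] at hps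
  exact hps (add_smul_mem_of_mem_chordSet hs)

/-- The set of those `x ∈ Ω` with `¬ p (Φ_θ x)` contains every chord that it meets, so it projects
to a null subset of the hyperplane. This covers predicates `p` that are not measurable, such as
those that involve an arbitrary directional trace. -/
theorem ae_dirMeasure_of_ae_exitPoint (hΩ : IsOpen Ω) (hb : Bornology.IsBounded Ω) (hθ : ‖θ‖ = 1)
    {p : E d → Prop} (h : ∀ᵐ x, x ∈ Ω → p (exitPoint Ω θ x)) : ∀ᵐ z ∂(dirMeasure Ω θ), p z := by
  have hθ0 : θ ≠ 0 := norm_ne_zero_iff.1 (hθ ▸ one_ne_zero)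
  filter_upwards [ae_dirMeasure_mem_image_exitPoint hΩ hb hθ0,
    ae_dirMeasure_proj hΩ hb hθ (ae_hyperplane_ae_of_ae hθ h)] with z ⟨x, hx, hxz⟩ hline
  rw [← hxz, exitPoint, proj_add_smul hθ] at hline
  exact hxz ▸ forall_exitPoint_of_ae_line hΩ hb hθ0 hline hx

theorem tendsto_comp_exitPoint_sub_smul {α : Type*} [TopologicalSpace α] {H : E d → α}
    (hΩ : IsOpen Ω) (hb : Bornology.IsBounded Ω) (hθ : θ ≠ 0)
    (hH : ∀ x, ∀ s ∈ chordSet Ω θ x, H (x + s • θ) = H x) (hx : x ∈ Ω) :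
    Filter.Tendsto (fun n : ℕ => H (exitPoint Ω θ x - (1 / ((n : ℝ) + 1)) • θ)) Filter.atTop
      (nhds (H x)) := by
  refine tendsto_const_nhds.congr' ?_
  filter_upwards [tendsto_one_div_add_atTop_nhds_zero_nat.eventually_lt_const
    (exitTime_pos hΩ hb hθ hx)] with n hn
  rw [exitPoint_sub_smul, hH x _ (exitTime_sub_mem_chordSet hΩ hb hθ Nat.one_div_pos_of_nat hn)]

section Transfer

variable {F : Type*} [NormedAddCommGroup F] {k : E d → F}

theorem aestronglyMeasurable_dirMeasure (hΩ : IsOpen Ω) (hb : Bornology.IsBounded Ω)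
    (hθ : ‖θ‖ = 1) {H : E d → F} (hHm : StronglyMeasurable H)
    (hH : ∀ x, ∀ s ∈ chordSet Ω θ x, H (x + s • θ) = H x)
    (hkH : ∀ᵐ x, x ∈ Ω → k (exitPoint Ω θ x) = H x) :
    AEStronglyMeasurable k (dirMeasure Ω θ) := by
  have hθ0 : θ ≠ 0 := norm_ne_zero_iff.1 (hθ ▸ one_ne_zero)
  refine aestronglyMeasurable_of_tendsto_ae Filter.atTop
    (f := fun (n : ℕ) z => H (z - (1 / ((n : ℝ) + 1)) • θ))
    (fun n => (hHm.comp_measurable (by fun_prop)).aestronglyMeasurable) ?_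
  refine ae_dirMeasure_of_ae_exitPoint hΩ hb hθ (hkH.mono fun x hx hxΩ => ?_)
  exact hx hxΩ ▸ tendsto_comp_exitPoint_sub_smul hΩ hb hθ0 hH hxΩ

theorem integrable_dirMeasure_and_integral_eq [NormedSpace ℝ F] [CompleteSpace F] (hΩ : IsOpen Ω)
    (hb : Bornology.IsBounded Ω) (hθ : ‖θ‖ = 1) {G : E d → F} (hGm : StronglyMeasurable G)
    (hG : IntegrableOn G Ω) (hk : ∀ᵐ x, x ∈ Ω → k (exitPoint Ω θ x) = chordAvg Ω θ G x) :
    Integrable k (dirMeasure Ω θ) ∧ ∫ z, k z ∂(dirMeasure Ω θ) = ∫ x in Ω, G x := by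
  have hθ0 : θ ≠ 0 := norm_ne_zero_iff.1 (hθ ▸ one_ne_zero)
  have hfin : ∀ x, volume (chordSet Ω θ x) ≠ ⊤ := fun x =>
    (isBounded_chordSet hb hθ0 x).measure_lt_top.ne
  have hkm := aestronglyMeasurable_dirMeasure hΩ hb hθ (stronglyMeasurable_chordAvg hΩ θ hGm)
    (fun _ _ => chordAvg_add_smul G) hk
  have hΦ := aemeasurable_exitPoint hΩ hb hθ
  have hk' : k ∘ exitPoint Ω θ =ᵐ[volume.restrict Ω] chordAvg Ω θ G :=
    (ae_restrict_iff' hΩ.measurableSet).2 hk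
  constructor
  · rw [dirMeasure, integrable_map_measure hkm hΦ]
    exact (integrable_chordAvg hΩ hfin hG).integrableOn.congr hk'.symm
  · rw [dirMeasure, integral_map hΦ hkm, ← setIntegral_chordAvg hΩ hfin hG]
    exact integral_congr_ae hk'

end Transfer

end DirMeasure

/-! ### The integration-by-parts formula -/

section IntegrationByParts

variable {d : ℕ} {Ω : Set (E d)} {θ : E d}

section ExtensionByZero

variable {u w : L2 Ω}

theorem stronglyMeasurable_indicator_L2 (hΩ : IsOpen Ω) (u : L2 Ω) :
    StronglyMeasurable (Ω.indicator u) :=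
  (Lp.stronglyMeasurable u).indicator hΩ.measurableSet

theorem memLp_two_indicator_L2 (hΩ : IsOpen Ω) (u : L2 Ω) : MemLp (Ω.indicator u) 2 :=
  (memLp_indicator_iff_restrict hΩ.measurableSet).2 (Lp.memLp u)

theorem integrable_indicator_L2 (hΩ : IsOpen Ω) (hb : Bornology.IsBounded Ω) (u : L2 Ω) :
    Integrable (Ω.indicator u) := by
  have : IsFiniteMeasure ((volume : Measure (E d)).restrict Ω) :=
    isFiniteMeasure_restrict.2 hb.measure_lt_top.ne
  exact (integrable_indicator_iff hΩ.measurableSet).2 ((Lp.memLp u).integrable one_le_two)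

theorem HasWeakDirDeriv.hasWeakDerivAlong (hΩ : IsOpen Ω) (h : HasWeakDirDeriv Ω θ u w) :
    HasWeakDerivAlong Ω θ volume (Ω.indicator u) (Ω.indicator w) := by
  intro φ hφ
  have hmul : ∀ (f : L2 Ω) (ψ : E d → ℝ),
      ∫ x, Ω.indicator f x * ψ x = ∫ x in Ω, f x * ψ x := fun f ψ => by
    simp only [← indicator_mul_left, integral_indicator hΩ.measurableSet]
  rw [hmul, hmul]
  exact h φ hφ

theorem HasWeakDirDeriv.ae_isPrimitiveOnChord (hΩ : IsOpen Ω) (hb : Bornology.IsBounded Ω)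
    (hθ : θ ≠ 0) (h : HasWeakDirDeriv Ω θ u w) :
    ∀ᵐ x, IsPrimitiveOnChord Ω θ (Ω.indicator u) (Ω.indicator w) x :=
  (h.hasWeakDerivAlong hΩ).ae_isPrimitiveOnChord hΩ hθ (integrable_indicator_L2 hΩ hb u)
    (stronglyMeasurable_indicator_L2 hΩ u).measurable (integrable_indicator_L2 hΩ hb w)
    (stronglyMeasurable_indicator_L2 hΩ w)

theorem HasWeakDirDeriv.ae_isPrimitiveOnChord_neg (hΩ : IsOpen Ω) (hb : Bornology.IsBounded Ω)
    (hθ : θ ≠ 0) (h : HasWeakDirDeriv Ω θ u w) :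
    ∀ᵐ x, IsPrimitiveOnChord Ω (-θ) (Ω.indicator u) (-Ω.indicator w) x :=
  (h.hasWeakDerivAlong hΩ).neg.ae_isPrimitiveOnChord hΩ (neg_ne_zero.2 hθ)
    (integrable_indicator_L2 hΩ hb u) (stronglyMeasurable_indicator_L2 hΩ u).measurable
    (integrable_indicator_L2 hΩ hb w).neg (stronglyMeasurable_indicator_L2 hΩ w).neg

theorem dirTrace_nonempty_of_mem_W (hΩ : IsOpen Ω) (hb : Bornology.IsBounded Ω) (hθ : ‖θ‖ = 1)
    (hu : u ∈ W Ω θ) : (dirTrace Ω θ u).Nonempty ∧ (dirTrace Ω (-θ) u).Nonempty := by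
  obtain ⟨w, hw⟩ := hu
  have hθ0 : θ ≠ 0 := norm_ne_zero_iff.1 (hθ ▸ one_ne_zero)
  have hu_ae : Ω.indicator u =ᵐ[volume.restrict Ω] u := indicator_ae_eq_restrict hΩ.measurableSet
  have hum := (stronglyMeasurable_indicator_L2 hΩ u).measurable
  have hwm := (stronglyMeasurable_indicator_L2 hΩ w).measurable
  have hu2 := memLp_two_indicator_L2 hΩ u
  have hw2 := memLp_two_indicator_L2 hΩ w
  exact ⟨dirTrace_nonempty hΩ hb hθ hu_ae hum hwm hu2 hw2 (hw.ae_isPrimitiveOnChord hΩ hb hθ0),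
    dirTrace_nonempty hΩ hb ((norm_neg θ).trans hθ) hu_ae hum hwm.neg hu2 hw2.neg
      (hw.ae_isPrimitiveOnChord_neg hΩ hb hθ0)⟩

end ExtensionByZero

theorem chordAvg_mul_add_mul_eq {f g v w : E d → ℝ} {x : E d} (hΩ : IsOpen Ω)
    (hb : Bornology.IsBounded Ω) (hθ : ‖θ‖ = 1) (hx : x ∈ Ω) (hf : IsPrimitiveOnChord Ω θ f w x)
    (hg : IsPrimitiveOnChord Ω θ g v x) :
    chordAvg Ω θ (fun z => f z * v z + g z * w z) x =
      (linePrimitive θ f w x (exitTime Ω θ x) * linePrimitive θ g v x (exitTime Ω θ x) -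
        linePrimitive θ f w x (-exitTime Ω (-θ) x) * linePrimitive θ g v x (-exitTime Ω (-θ) x)) /
          chordLength Ω θ (exitPoint Ω θ x) := by
  have hθ0 : θ ≠ 0 := norm_ne_zero_iff.1 (hθ ▸ one_ne_zero)
  rw [chordAvg, setAverage_eq, volume_real_chordSet hΩ hb hθ0 hx,
    hf.setIntegral_chordSet hg (chordSet_eq_Ioo hΩ hb hθ0 hx)
      (neg_nonpos.2 (exitTime_pos hΩ hb (neg_ne_zero.2 hθ0) hx).le) (exitTime_pos hΩ hb hθ0 hx).le,
    chordLength_exitPoint hΩ hb hθ hx, smul_eq_mul, inv_mul_eq_div]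

/-- The integrand of the boundary term: the jump of the product of the traces along the chord that
ends at `z`, divided by the length of this chord. Here `gu`, `gv` are traces in the direction `θ`
and `gu'`, `gv'` are traces in the direction `-θ`. -/
def chordJump (Ω : Set (E d)) (θ : E d) (gu gu' gv gv' : E d → ℝ) (z : E d) : ℝ :=
  (gu z * gv z - gu' (oppositePoint Ω θ z) * gv' (oppositePoint Ω θ z)) / chordLength Ω θ z

section Product

variable {u v wu wv : L2 Ω} {gu gu' gv gv' : E d → ℝ}

theorem ae_chordJump_exitPoint (hΩ : IsOpen Ω) (hb : Bornology.IsBounded Ω) (hθ : ‖θ‖ = 1)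
    (hu : HasWeakDirDeriv Ω θ u wu) (hv : HasWeakDirDeriv Ω θ v wv)
    (hgu : gu ∈ dirTrace Ω θ u) (hgu' : gu' ∈ dirTrace Ω (-θ) u)
    (hgv : gv ∈ dirTrace Ω θ v) (hgv' : gv' ∈ dirTrace Ω (-θ) v) :
    ∀ᵐ x, x ∈ Ω → chordJump Ω θ gu gu' gv gv' (exitPoint Ω θ x) =
      chordAvg Ω θ (fun z => u z * wv z + v z * wu z) x := by
  have hθ' : ‖-θ‖ = 1 := (norm_neg θ).trans hθ
  have hθ0 : θ ≠ 0 := norm_ne_zero_iff.1 (hθ ▸ one_ne_zero)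
  have hrepr : ∀ f : L2 Ω, Ω.indicator f =ᵐ[volume.restrict Ω] f := fun f =>
    indicator_ae_eq_restrict hΩ.measurableSet
  have hG : EqOn (fun z => u z * wv z + v z * wu z)
      (fun z => Ω.indicator u z * Ω.indicator wv z + Ω.indicator v z * Ω.indicator wu z) Ω :=
    fun z hz => by simp only [indicator_of_mem hz]
  have hpu := hu.ae_isPrimitiveOnChord hΩ hb hθ0
  have hpv := hv.ae_isPrimitiveOnChord hΩ hb hθ0
  filter_upwards [hpu, hpv, ae_dirTrace_exitPoint hΩ hb hθ (hrepr u) hpu hgu,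
    ae_dirTrace_exitPoint hΩ hb hθ (hrepr v) hpv hgv,
    ae_dirTrace_exitPoint hΩ hb hθ' (hrepr u) (hu.ae_isPrimitiveOnChord_neg hΩ hb hθ0) hgu',
    ae_dirTrace_exitPoint hΩ hb hθ' (hrepr v) (hv.ae_isPrimitiveOnChord_neg hΩ hb hθ0) hgv']
    with x hux hvx hgux hgvx hgux' hgvx' hx
  rw [chordJump, oppositePoint_exitPoint hΩ hb hθ hx, hgux hx, hgvx hx, hgux' hx, hgvx' hx,
    linePrimitive_neg, linePrimitive_neg, chordAvg_congr hΩ hG,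
    chordAvg_mul_add_mul_eq hΩ hb hθ hx hux hvx]

theorem integrableOn_mul_add_mul_L2 (u v wu wv : L2 Ω) :
    IntegrableOn (fun x => u x * wv x + v x * wu x) Ω :=
  ((Lp.memLp u).integrable_mul (Lp.memLp wv)).add ((Lp.memLp v).integrable_mul (Lp.memLp wu))

theorem integrable_chordJump_and_integral_eq (hΩ : IsOpen Ω) (hb : Bornology.IsBounded Ω)
    (hθ : ‖θ‖ = 1) (hu : HasWeakDirDeriv Ω θ u wu) (hv : HasWeakDirDeriv Ω θ v wv)
    (hgu : gu ∈ dirTrace Ω θ u) (hgu' : gu' ∈ dirTrace Ω (-θ) u)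
    (hgv : gv ∈ dirTrace Ω θ v) (hgv' : gv' ∈ dirTrace Ω (-θ) v) :
    Integrable (chordJump Ω θ gu gu' gv gv') (dirMeasure Ω θ) ∧
      ∫ z, chordJump Ω θ gu gu' gv gv' z ∂(dirMeasure Ω θ) =
        ∫ x in Ω, (u x * wv x + v x * wu x) :=
  integrable_dirMeasure_and_integral_eq hΩ hb hθ
    (((Lp.stronglyMeasurable u).mul (Lp.stronglyMeasurable wv)).add
      ((Lp.stronglyMeasurable v).mul (Lp.stronglyMeasurable wu)))
    (integrableOn_mul_add_mul_L2 u v wu wv)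
    (ae_chordJump_exitPoint hΩ hb hθ hu hv hgu hgu' hgv hgv')

end Product

end IntegrationByParts

end DirectionalTrace

end

theorem mainTheorem3 (d : ℕ) (Ω : Set (DirectionalTrace.E d)) (hΩ : IsOpen Ω)
    (hb : Bornology.IsBounded Ω) (θ : DirectionalTrace.E d) (hθ : ‖θ‖ = 1)
    (u v : DirectionalTrace.L2 Ω)
    (hu : u ∈ DirectionalTrace.W Ω θ) (hv : v ∈ DirectionalTrace.W Ω θ) :
    ((DirectionalTrace.dirTrace Ω θ u).Nonempty ∧ (DirectionalTrace.dirTrace Ω (-θ) u).Nonempty ∧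
      (DirectionalTrace.dirTrace Ω θ v).Nonempty ∧
      (DirectionalTrace.dirTrace Ω (-θ) v).Nonempty) ∧
    ∀ gu ∈ DirectionalTrace.dirTrace Ω θ u, ∀ gu' ∈ DirectionalTrace.dirTrace Ω (-θ) u,
    ∀ gv ∈ DirectionalTrace.dirTrace Ω θ v, ∀ gv' ∈ DirectionalTrace.dirTrace Ω (-θ) v,
      IntegrableOn (fun x => u x * DirectionalTrace.dirDeriv Ω θ v x +
        v x * DirectionalTrace.dirDeriv Ω θ u x) Ω ∧
      IntegrableOn (fun z => (gu z * gv z -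
        gu' (DirectionalTrace.oppositePoint Ω θ z) * gv' (DirectionalTrace.oppositePoint Ω θ z)) /
          DirectionalTrace.chordLength Ω θ z) (frontier Ω) (DirectionalTrace.dirMeasure Ω θ) ∧
      ∫ x in Ω, (u x * DirectionalTrace.dirDeriv Ω θ v x +
          v x * DirectionalTrace.dirDeriv Ω θ u x) =
        ∫ z in frontier Ω, (gu z * gv z -
          gu' (DirectionalTrace.oppositePoint Ω θ z) *
            gv' (DirectionalTrace.oppositePoint Ω θ z)) /
          DirectionalTrace.chordLength Ω θ z ∂(DirectionalTrace.dirMeasure Ω θ) := by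
  obtain ⟨hu₁, hu₂⟩ := DirectionalTrace.dirTrace_nonempty_of_mem_W hΩ hb hθ hu
  obtain ⟨hv₁, hv₂⟩ := DirectionalTrace.dirTrace_nonempty_of_mem_W hΩ hb hθ hv
  refine ⟨⟨hu₁, hu₂, hv₁, hv₂⟩, fun gu hgu gu' hgu' gv hgv gv' hgv' => ?_⟩
  obtain ⟨hint, heq⟩ := DirectionalTrace.integrable_chordJump_and_integral_eq hΩ hb hθ
    (DirectionalTrace.dirDeriv_spec hu) (DirectionalTrace.dirDeriv_spec hv) hgu hgu' hgv hgv'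
  have hfrontier := DirectionalTrace.restrict_frontier_dirMeasure hΩ hb (θ := θ)
    (norm_ne_zero_iff.1 (hθ ▸ one_ne_zero))
  refine ⟨DirectionalTrace.integrableOn_mul_add_mul_L2 u v _ _, hint.integrableOn, ?_⟩
  rw [hfrontier]
  exact heq.symm
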